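/- Let $K$ be a field. Let $Q_1=\Sigma^{-1}K\langle x,y\mid xy=1\rangle$ be the universal localization of the $K$-algebra $K\langle x,y\mid xy=1\rangle$ at the set $\Sigma=\{f(x) : f\in K[x],\ f(0)=1\}$, i.e. the $K$-algebra obtained by universally adjoining inverses of all elements of $\Sigma$. Let $\pi_1'\colon Q_1\to K(x)$ be the $K$-algebra homomorphism with $x\mapsto x$, $y\mapsto x^{-1}$, and let $\pi_2'\colon Q_1^{\mathrm{opp}}\to K(x)$ be the same map on the opposite algebra. Let $$Q=\{(\alpha,\beta)\in Q_1\times Q_1^{\mathrm{opp}} : \pi_1'(\alpha)=\pi_2'(\beta)\}$$ be their pullback. Let $\overline{\mathcal M}$ be the commutative monoid presented by generators $\bar y,\bar z,\bar x_0,\bar x_1,\bar x_2,\dots$ and relations $$\bar x_0+\bar y=\bar x_0+\bar z,\qquad \bar x_l=\bar x_{l+1}+\bar y=\bar x_{l+1}+\bar z\quad(l\ge 0).$$ For a unital ring $R$, let $V(R)$ be the monoid of equivalence classes $[e]$ of idempotent square matrices $e$ over $R$ of arbitrary finite size, where $e\sim f$ if there are rectangular matrices $u,v$ with $uv=e$ and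 $vu=f$, and $[e]+[f]=\left[\left(\begin{smallmatrix} e&0\\0&f\end{smallmatrix}\right)\right]$. Then the $K$-algebra $Q$ is von Neumann regular (for every $a\in Q$ there is $b\in Q$ with $aba=a$), and there is a monoid isomorphism $\psi\colon\overline{\mathcal M}\to V(Q)$ such that $$\psi(\bar x_n)=[(y^{n+1}x^{n+1},1)]=[(1,x^{n+1}\circ y^{n+1})]\ \ (n\ge 0),\qquad \psi(\bar y)=[e_1],\qquad \psi(\bar z)=[e_2],$$ where $e_1=(0,1-x\circ y)$, $e_2=(1-yx,0)$, and $\circ$ denotes the multiplication of $Q_1^{\mathrm{opp}}$. -/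

import Mathlib

universe u v w

/-! ### Von Neumann regular rings -/

/-- A ring `R` is (von Neumann) regular if every `a` has a quasi-inverse `b`: `a b a = a`. -/
def IsVNRegular (R : Type u) [Ring R] : Prop :=
  ∀ a : R, ∃ b : R, a * b * a = a

/-! ### The monoid `V(R)`, in the idempotent picture -/

section VMonoid

variable {R : Type u} [Ring R]

/-- Equivalence of square matrices `e`, `f` (possibly of different sizes): there are rectangular
matrices `a`, `b` with `a b = e` and `b a = f`. It is used for idempotent `e` and `f`. -/
def MatEquiv {m : Type v} {n : Type w} [Fintype m] [Fintype n]
    (e : Matrix m m R) (f : Matrix n n R) : Prop :=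
  ∃ (a : Matrix m n R) (b : Matrix n m R), a * b = e ∧ b * a = f

theorem MatEquiv.symm {m n : Type} [Fintype m] [Fintype n]
    {e : Matrix m m R} {f : Matrix n n R} (h : MatEquiv e f) : MatEquiv f e := by
  obtain ⟨a, b, h1, h2⟩ := h
  exact ⟨b, a, h2, h1⟩

theorem MatEquiv.refl {m : Type} [Fintype m] {e : Matrix m m R}
    (he : IsIdempotentElem e) : MatEquiv e e :=
  ⟨e, e, he, he⟩

theorem MatEquiv.trans {m n p : Type} [Fintype m] [Fintype n] [Fintype p]
    {e : Matrix m m R} {f : Matrix n n R} {g : Matrix p p R}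
    (he : IsIdempotentElem e) (hg : IsIdempotentElem g)
    (h : MatEquiv e f) (h' : MatEquiv f g) : MatEquiv e g := by
  obtain ⟨a, b, h1, h2⟩ := h
  obtain ⟨c, d, h3, h4⟩ := h'
  refine ⟨a * c, d * b, ?_, ?_⟩
  · calc a * c * (d * b) = a * (c * d) * b := by simp only [Matrix.mul_assoc]
      _ = (a * b) * (a * b) := by rw [h3, ← h2]; simp only [Matrix.mul_assoc]
      _ = e := by rw [h1]; exact he
  · calc d * b * (a * c) = d * (b * a) * c := by simp only [Matrix.mul_assoc]
      _ = (d * c) * (d * c) := by rw [h2, ← h3]; simp only [Matrix.mul_assoc]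
      _ = g := by rw [h4]; exact hg

theorem MatEquiv.reindex {m n : Type} [Fintype m] [Fintype n]
    {e : Matrix m m R} (he : IsIdempotentElem e) (σ : m ≃ n) :
    MatEquiv e (Matrix.reindex σ σ e) := by
  refine ⟨e.submatrix id σ.symm, e.submatrix σ.symm id, ?_, ?_⟩
  · rw [Matrix.submatrix_mul_equiv, he.eq, Matrix.submatrix_id_id]
  · have := Matrix.submatrix_mul e e σ.symm (id : m → m) σ.symm Function.bijective_id
    rw [he.eq] at this
    rw [← this]
    rfl

/-- The block sum of two square matrices, as a matrix indexed by `m ⊕ n`. -/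
def blockSum {m n : Type} (e : Matrix m m R) (f : Matrix n n R) :
    Matrix (m ⊕ n) (m ⊕ n) R :=
  Matrix.fromBlocks e 0 0 f

theorem blockSum_idem {m n : Type} [Fintype m] [Fintype n]
    {e : Matrix m m R} {f : Matrix n n R}
    (he : IsIdempotentElem e) (hf : IsIdempotentElem f) : IsIdempotentElem (blockSum e f) := by
  simp [IsIdempotentElem, blockSum, Matrix.fromBlocks_multiply, he.eq, hf.eq]

theorem reindex_idem {m n : Type} [Fintype m] [Fintype n]
    {e : Matrix m m R} (he : IsIdempotentElem e) (σ : m ≃ n) :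
    IsIdempotentElem (Matrix.reindex σ σ e) := by
  change e.submatrix σ.symm σ.symm * e.submatrix σ.symm σ.symm = e.submatrix σ.symm σ.symm
  rw [Matrix.submatrix_mul_equiv, he.eq]

theorem MatEquiv.blockSum {m n m' n' : Type} [Fintype m] [Fintype n] [Fintype m'] [Fintype n']
    {e : Matrix m m R} {f : Matrix n n R} {e' : Matrix m' m' R} {f' : Matrix n' n' R}
    (h : MatEquiv e e') (h' : MatEquiv f f') : MatEquiv (blockSum e f) (blockSum e' f') := by
  obtain ⟨a, b, h1, h2⟩ := h
  obtain ⟨c, d, h3, h4⟩ := h'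
  exact ⟨Matrix.fromBlocks a 0 0 c, Matrix.fromBlocks b 0 0 d,
    by simp [_root_.blockSum, Matrix.fromBlocks_multiply, h1, h3],
    by simp [_root_.blockSum, Matrix.fromBlocks_multiply, h2, h4]⟩

theorem MatEquiv.blockSum_comm {m n : Type} [Fintype m] [Fintype n]
    {e : Matrix m m R} {f : Matrix n n R}
    (he : IsIdempotentElem e) (hf : IsIdempotentElem f) :
    MatEquiv (_root_.blockSum e f) (_root_.blockSum f e) :=
  ⟨Matrix.fromBlocks 0 e f 0, Matrix.fromBlocks 0 f e 0,
    by simp [_root_.blockSum, Matrix.fromBlocks_multiply, he.eq, hf.eq],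
    by simp [_root_.blockSum, Matrix.fromBlocks_multiply, he.eq, hf.eq]⟩

theorem MatEquiv.blockSum_assoc {m n p : Type} [Fintype m] [Fintype n] [Fintype p]
    {e : Matrix m m R} {f : Matrix n n R} {g : Matrix p p R}
    (he : IsIdempotentElem e) (hf : IsIdempotentElem f) (hg : IsIdempotentElem g) :
    MatEquiv (_root_.blockSum (_root_.blockSum e f) g)
      (_root_.blockSum e (_root_.blockSum f g)) := by
  have h := MatEquiv.reindex (blockSum_idem (blockSum_idem he hf) hg) (Equiv.sumAssoc m n p)
  convert h using 1
  ext i j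
  rcases i with i | i | i <;> rcases j with j | j | j <;>
    simp [_root_.blockSum, Matrix.fromBlocks]

theorem MatEquiv.blockSum_zero {m n : Type} [Fintype m] [Fintype n] [IsEmpty m]
    {e : Matrix m m R} {f : Matrix n n R} (hf : IsIdempotentElem f) :
    MatEquiv (_root_.blockSum e f) f := by
  have he : e = 0 := Subsingleton.elim _ _
  subst he
  exact ⟨Matrix.fromRows 0 f, Matrix.fromCols 0 f,
    by ext i j; rcases i with i | i <;> rcases j with j | j <;>
      simp [_root_.blockSum, hf.eq],
    by simp [Matrix.fromCols_mul_fromRows, hf.eq]⟩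

variable (R) in
/-- Idempotent square matrices over `R`, of arbitrary finite size. -/
def IdemMat : Type u :=
  Σ n : ℕ, {e : Matrix (Fin n) (Fin n) R // IsIdempotentElem e}

/-- The block sum of two idempotent matrices, indexed by `Fin (m + n)`. -/
def IdemMat.add (e f : IdemMat R) : IdemMat R :=
  ⟨e.1 + f.1, Matrix.reindex finSumFinEquiv finSumFinEquiv (blockSum e.2.1 f.2.1),
    reindex_idem (blockSum_idem e.2.2 f.2.2) _⟩

/-- The empty matrix. -/
def IdemMat.zero : IdemMat R := ⟨0, 0, by simp [IsIdempotentElem]⟩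

/-- Equivalence of idempotent matrices. -/
instance IdemMat.setoid : Setoid (IdemMat R) where
  r e f := MatEquiv e.2.1 f.2.1
  iseqv :=
    { refl := fun e => MatEquiv.refl e.2.2
      symm := fun h => h.symm
      trans := fun {e _ g} h h' => MatEquiv.trans e.2.2 g.2.2 h h' }

theorem IdemMat.add_equiv (e f : IdemMat R) :
    MatEquiv (IdemMat.add e f).2.1 (blockSum e.2.1 f.2.1) :=
  (MatEquiv.reindex (blockSum_idem e.2.2 f.2.2) finSumFinEquiv).symm

theorem IdemMat.add_congr {e f e' f' : IdemMat R} (h : e ≈ e') (h' : f ≈ f') :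
    IdemMat.add e f ≈ IdemMat.add e' f' := by
  have hi := blockSum_idem e.2.2 f.2.2
  refine MatEquiv.trans (IdemMat.add e f).2.2 (IdemMat.add e' f').2.2 (IdemMat.add_equiv e f) ?_
  refine MatEquiv.trans hi (IdemMat.add e' f').2.2 ?_ (IdemMat.add_equiv e' f').symm
  exact MatEquiv.blockSum h h'

variable (R) in
/-- The monoid `V(R)`: equivalence classes of idempotent matrices over `R`. -/
def VMonoid : Type u := Quotient (IdemMat.setoid (R := R))

namespace VMonoid

/-- The class of an idempotent matrix. -/
def mk (e : IdemMat R) : VMonoid R := Quotient.mk _ e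

/-- The class `[e]` of an idempotent element `e` of `R`, seen as a `1 × 1` matrix. -/
def cls (e : R) (he : IsIdempotentElem e) : VMonoid R :=
  mk ⟨1, Matrix.of fun _ _ => e, by
    ext i j
    simp [Matrix.mul_apply, he.eq]⟩

instance : Zero (VMonoid R) := ⟨mk IdemMat.zero⟩

instance : Add (VMonoid R) :=
  ⟨Quotient.map₂ IdemMat.add fun _ _ h _ _ h' => IdemMat.add_congr h h'⟩

theorem mk_add (e f : IdemMat R) : mk e + mk f = mk (IdemMat.add e f) := rfl

theorem add_comm_aux (a b : VMonoid R) : a + b = b + a := by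
  induction a using Quotient.inductionOn with | _ e
  induction b using Quotient.inductionOn with | _ f
  refine Quotient.sound ?_
  refine MatEquiv.trans (IdemMat.add e f).2.2 (IdemMat.add f e).2.2 (IdemMat.add_equiv e f) ?_
  exact MatEquiv.trans (blockSum_idem e.2.2 f.2.2) (IdemMat.add f e).2.2
    (MatEquiv.blockSum_comm e.2.2 f.2.2) (IdemMat.add_equiv f e).symm

theorem zero_add_aux (a : VMonoid R) : 0 + a = a := by
  induction a using Quotient.inductionOn with | _ f
  refine Quotient.sound ?_
  have : IsEmpty (Fin (IdemMat.zero (R := R)).1) := inferInstanceAs (IsEmpty (Fin 0))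
  exact MatEquiv.trans (IdemMat.add IdemMat.zero f).2.2 f.2.2 (IdemMat.add_equiv _ _)
    (MatEquiv.blockSum_zero f.2.2)

theorem add_assoc_aux (a b c : VMonoid R) : a + b + c = a + (b + c) := by
  induction a using Quotient.inductionOn with | _ e
  induction b using Quotient.inductionOn with | _ f
  induction c using Quotient.inductionOn with | _ g
  refine Quotient.sound ?_
  have hl := (IdemMat.add (IdemMat.add e f) g).2.2
  have hr := (IdemMat.add e (IdemMat.add f g)).2.2
  have hL := blockSum_idem (blockSum_idem e.2.2 f.2.2) g.2.2
  have hR := blockSum_idem e.2.2 (blockSum_idem f.2.2 g.2.2)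
  have h1 : MatEquiv (IdemMat.add (IdemMat.add e f) g).2.1
      (blockSum (blockSum e.2.1 f.2.1) g.2.1) :=
    MatEquiv.trans hl hL (IdemMat.add_equiv _ _)
      (MatEquiv.blockSum (IdemMat.add_equiv e f) (MatEquiv.refl g.2.2))
  have h2 : MatEquiv (IdemMat.add e (IdemMat.add f g)).2.1
      (blockSum e.2.1 (blockSum f.2.1 g.2.1)) :=
    MatEquiv.trans hr hR (IdemMat.add_equiv _ _)
      (MatEquiv.blockSum (MatEquiv.refl e.2.2) (IdemMat.add_equiv f g))
  exact MatEquiv.trans hl hr h1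
    (MatEquiv.trans hL hr (MatEquiv.blockSum_assoc e.2.2 f.2.2 g.2.2) h2.symm)

instance : AddCommMonoid (VMonoid R) where
  add_assoc := add_assoc_aux
  zero_add := zero_add_aux
  add_zero a := by rw [add_comm_aux, zero_add_aux]
  add_comm := add_comm_aux
  nsmul := nsmulRec

end VMonoid

end VMonoid

/-! ### The monoid `M̄` -/

/-- The generators `x̄₀, x̄₁, x̄₂, …`, `ȳ`, `z̄` of `M̄`. -/
inductive MbarGen : Type
  | x (n : ℕ)
  | y
  | z

/-- The defining relations of `M̄`, on the free commutative monoid (of multisets):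
`x̄₀ + ȳ = x̄₀ + z̄`, `x̄ₗ = x̄ₗ₊₁ + ȳ` and `x̄ₗ = x̄ₗ₊₁ + z̄`. -/
inductive MbarRel : Multiset MbarGen → Multiset MbarGen → Prop
  | base : MbarRel ({.x 0} + {.y}) ({.x 0} + {.z})
  | stepY (l : ℕ) : MbarRel {.x l} ({.x (l + 1)} + {.y})
  | stepZ (l : ℕ) : MbarRel {.x l} ({.x (l + 1)} + {.z})

/-- The commutative monoid `M̄` presented by the above generators and relations. -/
abbrev Mbar : Type := (addConGen MbarRel).Quotient

namespace Mbar

/-- The class of a generator. -/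
def gen (g : MbarGen) : Mbar := AddCon.mk' (addConGen MbarRel) {g}

/-- The element `x̄ₙ`. -/
def x (n : ℕ) : Mbar := gen (.x n)

/-- The element `ȳ`. -/
def y : Mbar := gen .y

/-- The element `z̄`. -/
def z : Mbar := gen .z

end Mbar

noncomputable section

/-! ### Universal localization of an algebra at a set of elements -/

section UnivLoc

variable (K : Type u) [CommRing K] {A : Type v} [Ring A] [Algebra K A] (S : Set A)

/-- The relations of `S⁻¹A`, on the free algebra on a symbol for each element of `A` and a symbol
for (the inverse of) each element of `S`. -/
inductive UnivLocRel : FreeAlgebra K (A ⊕ S) → FreeAlgebra K (A ⊕ S) → Prop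
  | add (a b : A) : UnivLocRel (.ι K (.inl (a + b))) (.ι K (.inl a) + .ι K (.inl b))
  | mul (a b : A) : UnivLocRel (.ι K (.inl (a * b))) (.ι K (.inl a) * .ι K (.inl b))
  | scalar (k : K) : UnivLocRel (.ι K (.inl (algebraMap K A k))) (algebraMap K _ k)
  | mulInv (s : S) : UnivLocRel (.ι K (.inl (s : A)) * .ι K (.inr s)) 1
  | invMul (s : S) : UnivLocRel (.ι K (.inr s) * .ι K (.inl (s : A))) 1

/-- The universal localization `S⁻¹A`: the `K`-algebra obtained from `A` by universally adjoining
inverses of the elements of `S`. -/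
def UnivLoc : Type (max u v) := RingQuot (UnivLocRel K S)

instance : Ring (UnivLoc K S) := inferInstanceAs (Ring (RingQuot (UnivLocRel K S)))

instance : Algebra K (UnivLoc K S) := inferInstanceAs (Algebra K (RingQuot (UnivLocRel K S)))

namespace UnivLoc

/-- The quotient map onto `S⁻¹A`. -/
def quot : FreeAlgebra K (A ⊕ S) →ₐ[K] UnivLoc K S := RingQuot.mkAlgHom K (UnivLocRel K S)

variable {K S} in
theorem quot_rel {a b : FreeAlgebra K (A ⊕ S)} (h : UnivLocRel K S a b) :
    quot K S a = quot K S b :=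
  RingQuot.mkAlgHom_rel K h

/-- The canonical homomorphism `A → S⁻¹A`. -/
def of : A →ₐ[K] UnivLoc K S where
  toFun a := quot K S (.ι K (.inl a))
  map_one' := by
    rw [← map_one (algebraMap K A), quot_rel (.scalar 1), map_one, map_one]
  map_mul' a b := by rw [quot_rel (.mul a b), map_mul]
  map_zero' := by
    rw [← map_zero (algebraMap K A), quot_rel (.scalar 0), map_zero, map_zero]
  map_add' a b := by rw [quot_rel (.add a b), map_add]
  commutes' k := by rw [quot_rel (.scalar k), AlgHom.commutes]

theorem isUnit_of (s : A) (hs : s ∈ S) : IsUnit (of K S s) := by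
  refine ⟨⟨of K S s, quot K S (.ι K (.inr ⟨s, hs⟩)), ?_, ?_⟩, rfl⟩
  · have := quot_rel (UnivLocRel.mulInv (K := K) (⟨s, hs⟩ : S))
    rwa [map_mul, map_one] at this
  · have := quot_rel (UnivLocRel.invMul (K := K) (⟨s, hs⟩ : S))
    rwa [map_mul, map_one] at this

variable {K S} {B : Type w} [Ring B] [Algebra K B]

/-- The homomorphism `S⁻¹A → B` induced by a homomorphism `A → B` that inverts `S`. -/
def lift (f : A →ₐ[K] B) (hf : ∀ s ∈ S, IsUnit (f s)) : UnivLoc K S →ₐ[K] B :=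
  RingQuot.liftAlgHom K ⟨FreeAlgebra.lift K
      (Sum.elim f fun s : S => (((hf s s.2).unit⁻¹ : Bˣ) : B)), by
    intro a b h
    cases h <;> simp⟩

theorem lift_of (f : A →ₐ[K] B) (hf : ∀ s ∈ S, IsUnit (f s)) (a : A) :
    lift f hf (of K S a) = f a := by
  change RingQuot.liftAlgHom K _ (RingQuot.mkAlgHom K (UnivLocRel K S) _) = _
  rw [RingQuot.liftAlgHom_mkAlgHom_apply]
  simp

/-- Uniqueness in the universal property of `S⁻¹A`. -/
theorem hom_ext {g h : UnivLoc K S →ₐ[K] B} (H : ∀ a, g (of K S a) = h (of K S a)) : g = h := by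
  refine RingQuot.ringQuot_ext' K g h (FreeAlgebra.hom_ext (funext ?_))
  rintro (a | s)
  · exact H a
  · change g (quot K S (.ι K (.inr s))) = h (quot K S (.ι K (.inr s)))
    set t := quot K S (.ι K (.inr s)) with ht
    have h1 : of K S (s : A) * t = 1 := by
      have := quot_rel (UnivLocRel.mulInv (K := K) s)
      rwa [map_mul, map_one] at this
    have h2 : t * of K S (s : A) = 1 := by
      have := quot_rel (UnivLocRel.invMul (K := K) s)
      rwa [map_mul, map_one] at this
    have h3 : g t * g (of K S (s : A)) = 1 := by rw [← map_mul, h2, map_one]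
    have h4 : g (of K S (s : A)) * h t = 1 := by rw [H, ← map_mul, h1, map_one]
    exact left_inv_eq_right_inv h3 h4

end UnivLoc

end UnivLoc

/-! ### The algebras `K⟨x, y | xy = 1⟩` and `Q₁`, and the pullback `Q` -/

section Q

variable (K : Type u) [Field K]

/-- The relation `x y = 1`, where `x` and `y` are the free generators indexed by `true` and
`false`. -/
inductive ToeplitzRel : FreeAlgebra K Bool → FreeAlgebra K Bool → Prop
  | xy : ToeplitzRel (.ι K true * .ι K false) 1

/-- The algebra `K⟨x, y | xy = 1⟩`. -/
def Q0 : Type u := RingQuot (ToeplitzRel K)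

instance : Ring (Q0 K) := inferInstanceAs (Ring (RingQuot (ToeplitzRel K)))

instance : Algebra K (Q0 K) := inferInstanceAs (Algebra K (RingQuot (ToeplitzRel K)))

namespace Q0

/-- The quotient map onto `K⟨x, y | xy = 1⟩`. -/
def quot : FreeAlgebra K Bool →ₐ[K] Q0 K := RingQuot.mkAlgHom K (ToeplitzRel K)

/-- The generator `x`. -/
def x : Q0 K := quot K (.ι K true)

/-- The generator `y`. -/
def y : Q0 K := quot K (.ι K false)

theorem x_mul_y : x K * y K = 1 := by
  have h : quot K (.ι K true * .ι K false) = quot K 1 := RingQuot.mkAlgHom_rel K ToeplitzRel.xy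
  rwa [map_mul, map_one] at h

/-- The homomorphism `K⟨x, y | xy = 1⟩ → B` with `x ↦ a`, `y ↦ b`, if `ab = 1`. -/
def lift {K : Type u} [Field K] {B : Type w} [Ring B] [Algebra K B] (a b : B) (h : a * b = 1) :
    Q0 K →ₐ[K] B :=
  RingQuot.liftAlgHom K ⟨FreeAlgebra.lift K fun i => if i then a else b, by
    rintro _ _ ⟨⟩
    simp [h]⟩

variable {K} {B : Type w} [Ring B] [Algebra K B]

theorem lift_x (a b : B) (h : a * b = 1) : lift (K := K) a b h (x K) = a := by
  change RingQuot.liftAlgHom K _ (RingQuot.mkAlgHom K (ToeplitzRel K) _) = _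
  rw [RingQuot.liftAlgHom_mkAlgHom_apply]
  simp

theorem lift_y (a b : B) (h : a * b = 1) : lift (K := K) a b h (y K) = b := by
  change RingQuot.liftAlgHom K _ (RingQuot.mkAlgHom K (ToeplitzRel K) _) = _
  rw [RingQuot.liftAlgHom_mkAlgHom_apply]
  simp

end Q0

/-- The set `Σ` of all `f(x) ∈ K⟨x, y | xy = 1⟩` with `f` a polynomial such that `f(0) = 1`. -/
def sigmaSet : Set (Q0 K) :=
  {a | ∃ f : Polynomial K, f.eval 0 = 1 ∧ Polynomial.aeval (Q0.x K) f = a}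

/-- The algebra `Q₁ = Σ⁻¹ K⟨x, y | xy = 1⟩`. -/
abbrev Q1 : Type u := UnivLoc K (sigmaSet K)

namespace Q1

/-- The element `x` of `Q₁`. -/
def x : Q1 K := UnivLoc.of K (sigmaSet K) (Q0.x K)

/-- The element `y` of `Q₁`. -/
def y : Q1 K := UnivLoc.of K (sigmaSet K) (Q0.y K)

theorem x_mul_y : x K * y K = 1 := by
  rw [x, y, ← map_mul, Q0.x_mul_y, map_one]

/-- The homomorphism `K⟨x, y | xy = 1⟩ → K(x)` with `x ↦ x` and `y ↦ x⁻¹`. -/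
def toRatFuncAux : Q0 K →ₐ[K] RatFunc K :=
  Q0.lift RatFunc.X RatFunc.X⁻¹ (mul_inv_cancel₀ RatFunc.X_ne_zero)

theorem isUnit_toRatFuncAux (s : Q0 K) (hs : s ∈ sigmaSet K) : IsUnit (toRatFuncAux K s) := by
  obtain ⟨f, hf, rfl⟩ := hs
  have hx : toRatFuncAux K (Q0.x K) = algebraMap (Polynomial K) (RatFunc K) Polynomial.X := by
    rw [toRatFuncAux, Q0.lift_x, RatFunc.algebraMap_X]
  rw [← Polynomial.aeval_algHom_apply, hx, Polynomial.aeval_algebraMap_apply,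
    Polynomial.aeval_X_left_apply, isUnit_iff_ne_zero]
  refine RatFunc.algebraMap_ne_zero ?_
  rintro rfl
  simp at hf

/-- The quotient map `Q₁ → K(x)`: the homomorphism with `x ↦ x` and `y ↦ x⁻¹`. -/
def toRatFunc : Q1 K →ₐ[K] RatFunc K :=
  UnivLoc.lift (toRatFuncAux K) (isUnit_toRatFuncAux K)

theorem toRatFunc_x : toRatFunc K (x K) = RatFunc.X := by
  rw [toRatFunc, x, UnivLoc.lift_of, toRatFuncAux, Q0.lift_x]

theorem toRatFunc_y : toRatFunc K (y K) = RatFunc.X⁻¹ := by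
  rw [toRatFunc, y, UnivLoc.lift_of, toRatFuncAux, Q0.lift_y]

/-- The same quotient map, on the opposite algebra: `Q₁ᵒᵖᵖ → K(x)`, `x ↦ x`, `y ↦ x⁻¹`. -/
def opToRatFunc : (Q1 K)ᵐᵒᵖ →ₐ[K] RatFunc K :=
  (toRatFunc K).fromOpposite fun _ _ => Commute.all _ _

theorem opToRatFunc_op (a : Q1 K) : opToRatFunc K (MulOpposite.op a) = toRatFunc K a := rfl

end Q1

/-- The pullback of `Q₁ → K(x) ← Q₁ᵒᵖᵖ`, as the subalgebra of `Q₁ × Q₁ᵒᵖᵖ` of all pairs with equal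
images in `K(x)`. -/
def pullbackQ : Subalgebra K (Q1 K × (Q1 K)ᵐᵒᵖ) :=
  AlgHom.equalizer ((Q1.toRatFunc K).comp (AlgHom.fst K (Q1 K) (Q1 K)ᵐᵒᵖ))
    ((Q1.opToRatFunc K).comp (AlgHom.snd K (Q1 K) (Q1 K)ᵐᵒᵖ))

/-- The `K`-algebra `Q`. -/
abbrev Q : Type u := pullbackQ K

namespace Q

theorem mem_iff (p : Q1 K × (Q1 K)ᵐᵒᵖ) :
    p ∈ pullbackQ K ↔ Q1.toRatFunc K p.1 = Q1.opToRatFunc K p.2 := Iff.rfl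

/-- The element `x` of `Q₁ᵒᵖᵖ`. -/
def ox : (Q1 K)ᵐᵒᵖ := MulOpposite.op (Q1.x K)

/-- The element `y` of `Q₁ᵒᵖᵖ`. -/
def oy : (Q1 K)ᵐᵒᵖ := MulOpposite.op (Q1.y K)

theorem oy_mul_ox : oy K * ox K = 1 := by
  rw [oy, ox, ← MulOpposite.op_mul, Q1.x_mul_y, MulOpposite.op_one]

theorem toRatFunc_yx (n : ℕ) : Q1.toRatFunc K (Q1.y K ^ n * Q1.x K ^ n) = 1 := by
  rw [map_mul, map_pow, map_pow, Q1.toRatFunc_x, Q1.toRatFunc_y, ← mul_pow,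
    inv_mul_cancel₀ RatFunc.X_ne_zero, one_pow]

theorem opToRatFunc_xy (n : ℕ) : Q1.opToRatFunc K (ox K ^ n * oy K ^ n) = 1 := by
  rw [map_mul, map_pow, map_pow, ox, oy, Q1.opToRatFunc_op, Q1.opToRatFunc_op, Q1.toRatFunc_x,
    Q1.toRatFunc_y, ← mul_pow, mul_inv_cancel₀ RatFunc.X_ne_zero, one_pow]

/-- The element `(yⁿ xⁿ, 1)` of `Q`. -/
def p (n : ℕ) : Q K :=
  ⟨(Q1.y K ^ n * Q1.x K ^ n, 1), by
    rw [mem_iff, toRatFunc_yx, map_one]⟩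

/-- The element `(1, xⁿ ∘ yⁿ)` of `Q`, with `∘` the multiplication of `Q₁ᵒᵖᵖ`. -/
def q (n : ℕ) : Q K :=
  ⟨(1, ox K ^ n * oy K ^ n), by
    rw [mem_iff, opToRatFunc_xy, map_one]⟩

/-- The element `e₁ = (0, 1 - x ∘ y)` of `Q`, with `∘` the multiplication of `Q₁ᵒᵖᵖ`. -/
def e₁ : Q K :=
  ⟨(0, 1 - ox K * oy K), by
    have h := opToRatFunc_xy K 1
    rw [pow_one, pow_one] at h
    rw [mem_iff, map_sub, h, map_one, map_zero, sub_self]⟩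

/-- The element `e₂ = (1 - y x, 0)` of `Q`. -/
def e₂ : Q K :=
  ⟨(1 - Q1.y K * Q1.x K, 0), by
    have h := toRatFunc_yx K 1
    rw [pow_one, pow_one] at h
    rw [mem_iff, map_sub, h, map_one, map_zero, sub_self]⟩

theorem idem_aux {B : Type w} [Ring B] {a b : B} (h : a * b = 1) (n : ℕ) :
    IsIdempotentElem (b ^ n * a ^ n) := by
  have hn : a ^ n * b ^ n = 1 := by
    induction n with
    | zero => simp
    | succ k ih =>
      rw [pow_succ a, pow_succ' b, mul_assoc, ← mul_assoc a b, h, one_mul, ih]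
  change b ^ n * a ^ n * (b ^ n * a ^ n) = b ^ n * a ^ n
  rw [mul_assoc, ← mul_assoc (a ^ n), hn, one_mul]

theorem idem_aux_one {B : Type w} [Ring B] {a b : B} (h : a * b = 1) :
    IsIdempotentElem (1 - b * a) := by
  have h1 := idem_aux h 1
  rw [pow_one, pow_one] at h1
  exact h1.one_sub

theorem p_idem (n : ℕ) : IsIdempotentElem (p K n) :=
  Subtype.ext (Prod.ext (idem_aux (Q1.x_mul_y K) n) (mul_one 1))

theorem q_idem (n : ℕ) : IsIdempotentElem (q K n) :=
  Subtype.ext (Prod.ext (mul_one 1) (idem_aux (oy_mul_ox K) n))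

theorem e₁_idem : IsIdempotentElem (e₁ K) :=
  Subtype.ext (Prod.ext (mul_zero 0) (idem_aux_one (oy_mul_ox K)))

theorem e₂_idem : IsIdempotentElem (e₂ K) :=
  Subtype.ext (Prod.ext (idem_aux_one (Q1.x_mul_y K)) (mul_zero 0))

end Q

end Q

end

/-! The map `toRatFunc` presents Q as an extension of the field K(x) by its kernel I, and I consists
of the sums (a, 0) + (0, b) with a and b in the kernel of Q₁ → K(x). The elements (a, 0) are sums of
products uw with u in Q e₂ and w in e₂ Q. The elements (0, b) are such sums for e₁. Both corners eᵢ
Q eᵢ equal K eᵢ, and matrices over either part of I can be treated by Gaussian elimination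
(`FactorsThrough.step`): they have quasi-inverses, and their idempotents have class a multiple of
[eᵢ]. Since K(x) is a field and I is regular, Q is regular.

The elements X = (x, x) and Y = (y, y) satisfy YⁿXⁿ = p n and XⁿYⁿ = q n, so [p n] = [q n]. Passing
from p n to p (n+1) removes a copy of e₂, and passing from q n to q (n+1) removes a copy of e₁;
these are the relations of M̄. For surjectivity, let E be an idempotent matrix of rank k over K(x).
An isomorphism over K(x) lifts to Q up to an error in I, and X^L kills the error from both sides. So
k copies of p (2L) split off E, and the rest of E is an idempotent over I (`exists_ofMat_eq`).

For injectivity, every element of M̄ has the form aȳ + bz̄ or kx̄₀ + x̄_N + nȳ. The rank over K(x)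
separates the two forms and gives k. The projections to the two coordinates give b and a. It remains
to recover n - N, that is, to show that k[1] + a[e₁] determines a (`eq_of_nsmul_add_nsmul_eq`). This
is a Fredholm index argument. Q₁ acts on the polar part of K(x) at 0 and Q₁ᵒᵖᵖ acts on the regular
part, and on the sum an element of Q acts as multiplication by its image in K(x), up to finite rank
(`isFinRank_rep_sub`). An invertible matrix over K(x) acts bijectively, so a finite-rank
perturbation of it has index 0, whereas e₁ acts with finite nonzero rank; hence the copies of e₁ can
be counted. -/

noncomputable section

/-! ### Classes of idempotent matrices in `V(R)` -/

namespace VMonoid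

variable {R : Type u} [Ring R] {S : Type v} [Ring S]

/-- An idempotent matrix over `R`, as an element of `IdemMat R`. -/
def _root_.IdemMat.of {n : ℕ} (E : Matrix (Fin n) (Fin n) R) (hE : IsIdempotentElem E) :
    IdemMat R :=
  ⟨n, E, hE⟩

/-- The class of an idempotent matrix indexed by an arbitrary finite type. -/
def ofMat {n : Type} [Fintype n] (E : Matrix n n R) (hE : IsIdempotentElem E) : VMonoid R :=
  mk (.of (Matrix.reindex (Fintype.equivFin n) (Fintype.equivFin n) E) (reindex_idem hE _))

theorem ofMat_eq_iff {m n : Type} [Fintype m] [Fintype n] {E : Matrix m m R} {F : Matrix n n R}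
    (hE : IsIdempotentElem E) (hF : IsIdempotentElem F) :
    ofMat E hE = ofMat F hF ↔ MatEquiv E F := by
  have h1 := MatEquiv.reindex hE (Fintype.equivFin m)
  have h2 := MatEquiv.reindex hF (Fintype.equivFin n)
  have i1 := reindex_idem hE (Fintype.equivFin m)
  have i2 := reindex_idem hF (Fintype.equivFin n)
  constructor
  · intro h
    have h3 : MatEquiv (Matrix.reindex (Fintype.equivFin m) (Fintype.equivFin m) E)
      (Matrix.reindex (Fintype.equivFin n) (Fintype.equivFin n) F) := Quotient.exact h
    exact (h1.trans hE i2 h3).trans hE hF h2.symm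
  · intro h
    exact Quotient.sound ((h1.symm.trans i1 hF h).trans i1 i2 h2)

theorem mk_of {n : ℕ} {E : Matrix (Fin n) (Fin n) R} (hE : IsIdempotentElem E) :
    mk (.of E hE) = ofMat E hE :=
  Quotient.sound (MatEquiv.reindex hE _)

theorem mk_eq_ofMat (E : IdemMat R) : mk E = ofMat E.2.1 E.2.2 :=
  Quotient.sound (MatEquiv.reindex E.2.2 _)

theorem ofMat_blockSum {m n : Type} [Fintype m] [Fintype n] {E : Matrix m m R} {F : Matrix n n R}
    (hE : IsIdempotentElem E) (hF : IsIdempotentElem F) :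
    ofMat (blockSum E F) (blockSum_idem hE hF) = ofMat E hE + ofMat F hF := by
  symm
  rw [ofMat, ofMat, mk_add, mk_eq_ofMat, ofMat_eq_iff]
  refine (IdemMat.add_equiv _ _).trans (IdemMat.add _ _).2.2 (blockSum_idem hE hF) ?_
  exact (MatEquiv.reindex hE _).symm.blockSum (MatEquiv.reindex hF _).symm

theorem diagonal_idem {e : R} (he : IsIdempotentElem e) (n : Type) [Fintype n] [DecidableEq n] :
    IsIdempotentElem (Matrix.diagonal fun _ : n => e) := by
  rw [IsIdempotentElem, Matrix.diagonal_mul_diagonal, he.eq]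

theorem ofMat_isEmpty {n : Type} [Fintype n] [IsEmpty n] (E : Matrix n n R)
    (hE : IsIdempotentElem E) : ofMat E hE = 0 := by
  change _ = mk IdemMat.zero
  rw [mk_eq_ofMat, ofMat_eq_iff]
  have : IsEmpty (Fin (IdemMat.zero (R := R)).1) := inferInstanceAs (IsEmpty (Fin 0))
  exact ⟨0, 0, Subsingleton.elim _ _, Subsingleton.elim _ _⟩

theorem ofMat_zero {n : Type} [Fintype n] (h : IsIdempotentElem (0 : Matrix n n R)) :
    ofMat (0 : Matrix n n R) h = 0 := by
  rw [← ofMat_isEmpty (0 : Matrix (Fin 0) (Fin 0) R) (IsIdempotentElem.zero), ofMat_eq_iff]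
  exact ⟨0, 0, by simp, by simp⟩

theorem ofMat_congr {n : Type} [Fintype n] {E F : Matrix n n R} (h : E = F)
    (hE : IsIdempotentElem E) (hF : IsIdempotentElem F) : ofMat E hE = ofMat F hF := by
  subst h; rfl

theorem cls_eq_ofMat {e : R} (he : IsIdempotentElem e) :
    cls e he = ofMat (Matrix.diagonal fun _ : Unit => e) (diagonal_idem he Unit) := by
  have h : IsIdempotentElem (Matrix.of fun _ _ : Fin 1 => e) := by
    ext i j
    simp [Matrix.mul_apply, he.eq]
  refine (mk_of h).trans ?_
  rw [ofMat_eq_iff]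
  refine ⟨Matrix.of fun _ _ => e, Matrix.of fun _ _ => e, ?_, ?_⟩
  · ext i j
    simp [Matrix.mul_apply, he.eq]
  · ext i j
    simp [Matrix.mul_apply, he.eq]

theorem cls_congr {e f : R} (h : e = f) (he : IsIdempotentElem e) (hf : IsIdempotentElem f) :
    cls e he = cls f hf := by
  subst h; rfl

theorem cls_zero (h : IsIdempotentElem (0 : R)) : cls (0 : R) h = 0 := by
  rw [cls_eq_ofMat, ← ofMat_zero (n := Unit) IsIdempotentElem.zero]
  exact ofMat_congr (by ext; simp) _ _

/-- Idempotents `ab` and `ba` have the same class. -/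
theorem cls_eq_cls {e f : R} (he : IsIdempotentElem e) (hf : IsIdempotentElem f) (a b : R)
    (h1 : a * b = e) (h2 : b * a = f) : cls e he = cls f hf := by
  rw [cls_eq_ofMat, cls_eq_ofMat, ofMat_eq_iff]
  refine ⟨Matrix.diagonal fun _ => a, Matrix.diagonal fun _ => b, ?_, ?_⟩
  · rw [Matrix.diagonal_mul_diagonal, h1]
  · rw [Matrix.diagonal_mul_diagonal, h2]

theorem ofMat_diagonal {e : R} (he : IsIdempotentElem e) (k : ℕ) :
    ofMat (Matrix.diagonal fun _ : Fin k => e) (diagonal_idem he _) = k • cls e he := by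
  induction k with
  | zero => rw [zero_smul, ofMat_isEmpty]
  | succ k ih =>
    rw [succ_nsmul, ← ih, cls_eq_ofMat, ← ofMat_blockSum, ofMat_eq_iff]
    have h := MatEquiv.reindex (blockSum_idem (diagonal_idem he (Fin k)) (diagonal_idem he Unit))
      (show Fin k ⊕ Unit ≃ Fin (k + 1) from
        (Equiv.sumCongr (Equiv.refl _) (Equiv.ofUnique Unit (Fin 1))).trans finSumFinEquiv)
    have h2 : blockSum (Matrix.diagonal fun _ : Fin k => e) (Matrix.diagonal fun _ : Unit => e)
        = Matrix.diagonal fun _ : Fin k ⊕ Unit => e := by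
      rw [blockSum, Matrix.fromBlocks_diagonal]
      congr 1
      ext i
      rcases i with i | i <;> rfl
    rw [h2, Matrix.reindex_apply, Matrix.submatrix_diagonal_equiv] at h
    rw [h2]
    exact h.symm

/-- The class of a sum of two orthogonal idempotents. -/
theorem ofMat_add {n : Type} [Fintype n] {G H : Matrix n n R} (hG : IsIdempotentElem G)
    (hH : IsIdempotentElem H) (hGH : G * H = 0) (hHG : H * G = 0)
    (h : IsIdempotentElem (G + H)) : ofMat (G + H) h = ofMat G hG + ofMat H hH := by
  rw [← ofMat_blockSum, ofMat_eq_iff]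
  refine ⟨Matrix.fromCols G H, Matrix.fromRows G H, ?_, ?_⟩
  · rw [Matrix.fromCols_mul_fromRows, hG.eq, hH.eq]
  · rw [Matrix.fromRows_mul_fromCols, hG.eq, hH.eq, hGH, hHG, blockSum]

theorem cls_add {e f g : R} (he : IsIdempotentElem e) (hf : IsIdempotentElem f)
    (hg : IsIdempotentElem g) (h1 : e * f = 0) (h2 : f * e = 0) (h : e + f = g) :
    cls g hg = cls e he + cls f hf := by
  have h3 : (Matrix.diagonal fun _ : Unit => g) =
      (Matrix.diagonal fun _ : Unit => e) + Matrix.diagonal fun _ : Unit => f := by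
    rw [Matrix.diagonal_add, h]
  simp only [cls_eq_ofMat]
  rw [← ofMat_add _ _ _ _ (h3 ▸ diagonal_idem hg _)]
  · exact ofMat_congr h3 _ _
  · rw [Matrix.diagonal_mul_diagonal, h1]; exact Matrix.diagonal_zero
  · rw [Matrix.diagonal_mul_diagonal, h2]; exact Matrix.diagonal_zero

theorem map_idem (f : R →+* S) {n : Type} [Fintype n] {E : Matrix n n R}
    (hE : IsIdempotentElem E) : IsIdempotentElem (E.map f) := by
  rw [IsIdempotentElem, ← Matrix.map_mul, hE.eq]

theorem _root_.MatEquiv.map (f : R →+* S) {m n : Type} [Fintype m] [Fintype n]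
    {E : Matrix m m R} {F : Matrix n n R} (h : MatEquiv E F) : MatEquiv (E.map f) (F.map f) := by
  obtain ⟨a, b, rfl, rfl⟩ := h
  exact ⟨a.map f, b.map f, by rw [Matrix.map_mul], by rw [Matrix.map_mul]⟩

/-- The functoriality of `V`. -/
def map (f : R →+* S) : VMonoid R →+ VMonoid S where
  toFun := Quotient.map (fun E : IdemMat R => IdemMat.of (E.2.1.map f) (map_idem f E.2.2))
    fun _ _ h => MatEquiv.map f h
  map_zero' := by
    change mk (IdemMat.of _ _) = mk IdemMat.zero
    rw [mk_of, mk_eq_ofMat, ofMat_eq_iff]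
    have : IsEmpty (Fin (IdemMat.zero (R := R)).1) := inferInstanceAs (IsEmpty (Fin 0))
    have : IsEmpty (Fin (IdemMat.zero (R := S)).1) := inferInstanceAs (IsEmpty (Fin 0))
    exact ⟨0, 0, Subsingleton.elim _ _, Subsingleton.elim _ _⟩
  map_add' a b := by
    induction a using Quotient.inductionOn with | _ E
    induction b using Quotient.inductionOn with | _ F
    change mk (IdemMat.of _ _) = mk (IdemMat.add (IdemMat.of _ _) (IdemMat.of _ _))
    rw [mk_of, mk_eq_ofMat]
    refine ofMat_congr ?_ _ _
    ext i j
    change f (blockSum E.2.1 F.2.1 (finSumFinEquiv.symm i) (finSumFinEquiv.symm j)) =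
      blockSum (E.2.1.map f) (F.2.1.map f) (finSumFinEquiv.symm i) (finSumFinEquiv.symm j)
    rcases finSumFinEquiv.symm i with i | i <;> rcases finSumFinEquiv.symm j with j | j <;>
      simp [blockSum]

theorem map_cls (f : R →+* S) {e : R} (he : IsIdempotentElem e) :
    map f (cls e he) = cls (f e) (he.map f) := rfl

end VMonoid

end

/-! ### Gaussian elimination over the corner of an idempotent -/

noncomputable section

section Corner

variable {R : Type u} [Ring R] {e : R}

/-- An idempotent `e` such that `R e` and `e R` are separated from zero by the corner `e R e`,
whose nonzero elements obtained this way can be normalized to `e`. -/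
structure IsSeparating (e : R) : Prop where
  idem : IsIdempotentElem e
  left : ∀ a, a * e ≠ 0 → ∃ b, b * a * e = e
  right : ∀ a, e * a ≠ 0 → ∃ b, e * a * b = e

/-- The scalar matrix with diagonal entries `e`. -/
abbrev diagMat (e : R) (n : Type) [DecidableEq n] : Matrix n n R := Matrix.diagonal fun _ => e

/-- `α` is a product of a matrix over `R e` with `r` columns and a matrix over `e R`. -/
def FactorsThrough (e : R) (r : ℕ) {m n : Type} (α : Matrix m n R) : Prop :=
  ∃ (U : Matrix m (Fin r) R) (W : Matrix (Fin r) n R),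
    U * diagMat e (Fin r) = U ∧ diagMat e (Fin r) * W = W ∧ α = U * W

theorem FactorsThrough.of_fintype {m n ι : Type} [Fintype ι] [DecidableEq ι]
    (U : Matrix m ι R) (W : Matrix ι n R) (hU : ∀ i j, U i j * e = U i j)
    (hW : ∀ i j, e * W i j = W i j) : FactorsThrough e (Fintype.card ι) (U * W) := by
  refine ⟨U.submatrix id (Fintype.equivFin ι).symm, W.submatrix (Fintype.equivFin ι).symm id,
    ?_, ?_, ?_⟩
  · ext i j
    simp [Matrix.mul_diagonal, hU]
  · ext i j
    simp [Matrix.diagonal_mul, hW]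
  · rw [Matrix.submatrix_mul_equiv, Matrix.submatrix_id_id]

/-- Elimination of one term in a factorization. -/
theorem FactorsThrough.step (he : IsSeparating e) {m n : Type} [Fintype m] [Fintype n] {r : ℕ}
    {α : Matrix m n R} (h : FactorsThrough e (r + 1) α) :
    ∃ (w' : Matrix n Unit R) (b : Matrix Unit m R),
      (b = 0 ∨ b * (α * w') = diagMat e Unit ∧ w' * diagMat e Unit = w') ∧
      FactorsThrough e r (α - α * w' * (b * α)) := by
  classical
  obtain ⟨U, W, hU, hW, hα⟩ := h
  -- The last term is split off: α = U₀W₀ + uw, with u the last column of U and w the last row of W.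
  set U₀ : Matrix m (Fin r) R := U.submatrix id Fin.castSucc with hU₀
  set W₀ : Matrix (Fin r) n R := W.submatrix Fin.castSucc id with hW₀
  set u : Matrix m Unit R := U.submatrix id (fun _ => Fin.last r) with hu
  set w : Matrix Unit n R := W.submatrix (fun _ => Fin.last r) id with hw
  have hU' : ∀ i j, U i j * e = U i j := fun i j => by
    conv_rhs => rw [← hU]
    rw [Matrix.mul_diagonal]
  have hW' : ∀ i j, e * W i j = W i j := fun i j => by
    conv_rhs => rw [← hW]
    rw [Matrix.diagonal_mul]
  have hU₀e : U₀ * diagMat e (Fin r) = U₀ := by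
    ext i j
    rw [Matrix.mul_diagonal]
    exact hU' _ _
  have hW₀e : diagMat e (Fin r) * W₀ = W₀ := by
    ext i j
    rw [Matrix.diagonal_mul]
    exact hW' _ _
  have hue : u * diagMat e Unit = u := by
    ext i j
    rw [Matrix.mul_diagonal]
    exact hU' _ _
  have hsum : α = U₀ * W₀ + u * w := by
    ext i j
    rw [hα, Matrix.mul_apply, Fin.sum_univ_castSucc, Matrix.add_apply, Matrix.mul_apply,
      Matrix.mul_apply]
    simp [U₀, W₀, u, w]
  by_cases hw0 : w = 0
  · refine ⟨0, 0, Or.inl rfl, U₀, W₀, hU₀e, hW₀e, ?_⟩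
    rw [hsum, hw0]
    simp
  obtain ⟨i₀, hi₀⟩ : ∃ i, W (Fin.last r) i ≠ 0 := by
    by_contra! hcon
    exact hw0 (by ext i j; exact hcon j)
  rw [← hW'] at hi₀
  obtain ⟨b₀, hb₀⟩ := he.right _ hi₀
  rw [hW'] at hb₀
  -- The column w' normalizes the row w, so that ww' = e. Its entry is b₀e rather than b₀ so that
  -- w'e = w'.
  set w' : Matrix n Unit R := Matrix.of fun i _ => if i = i₀ then b₀ * e else 0 with hw'
  have hww' : w * w' = diagMat e Unit := by
    ext i j
    simp [w, w', Matrix.mul_apply, ← mul_assoc, hb₀, he.idem.eq]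
  have hw'e : w' * diagMat e Unit = w' := by
    ext i j
    rw [Matrix.mul_diagonal]
    simp only [w', Matrix.of_apply]
    split_ifs
    · rw [mul_assoc, he.idem.eq]
    · rw [zero_mul]
  set γ := α * w' with hγ
  have hγe : γ * diagMat e Unit = γ := by rw [hγ, Matrix.mul_assoc, hw'e]
  -- Since αw' = U₀W₀w' + u, the column u can be replaced by γ = αw' at the cost of a term starting
  -- with U₀.
  have hγu : u = γ - U₀ * (W₀ * w') := by
    rw [hγ, hsum, Matrix.add_mul, Matrix.mul_assoc u, hww', hue, Matrix.mul_assoc]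
    simp
  -- If γbγ = γ, then subtracting γbα removes the γ-term and leaves (U₀ - γbU₀)(W₀ - W₀w'w), with
  -- only r terms. This covers both cases below: γ = 0 with b = 0, and bγ = e.
  have key : ∀ b : Matrix Unit m R, γ * (b * γ) = γ → FactorsThrough e r (α - γ * (b * α)) := by
    intro b hb
    refine ⟨U₀ - γ * (b * U₀), W₀ - W₀ * w' * w, ?_, ?_, ?_⟩
    · rw [Matrix.sub_mul, Matrix.mul_assoc γ, Matrix.mul_assoc b, hU₀e]
    · rw [Matrix.mul_sub, Matrix.mul_assoc, ← Matrix.mul_assoc, hW₀e]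
    · have h1 : u * w = γ * w - U₀ * (W₀ * (w' * w)) := by
        conv_lhs => rw [hγu]
        simp only [Matrix.sub_mul, Matrix.mul_assoc]
      have h2 : γ * (b * (γ * w)) = γ * w := by
        conv_rhs => rw [← hb]
        simp only [Matrix.mul_assoc]
      have h3 : α = U₀ * W₀ + (γ * w - U₀ * (W₀ * (w' * w))) := by rw [hsum, h1]
      clear_value γ
      rw [h3]
      simp only [Matrix.mul_add, Matrix.mul_sub, Matrix.sub_mul, Matrix.mul_assoc, h2]
      abel
  by_cases hγ0 : γ = 0
  · refine ⟨w', 0, Or.inl rfl, ?_⟩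
    exact key 0 (by rw [hγ0]; simp)
  obtain ⟨i₁, hi₁⟩ : ∃ i, γ i () ≠ 0 := by
    by_contra! hcon
    exact hγ0 (by ext i j; exact hcon i)
  have hγe' : ∀ i, γ i () * e = γ i () := fun i => by
    conv_rhs => rw [← hγe]
    rw [Matrix.mul_diagonal]
  rw [← hγe'] at hi₁
  obtain ⟨b₁, hb₁⟩ := he.left _ hi₁
  rw [mul_assoc, hγe'] at hb₁
  set b : Matrix Unit m R := Matrix.of fun _ i => if i = i₁ then b₁ else 0 with hb
  have hbγ : b * γ = diagMat e Unit := by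
    ext i j
    simp [b, Matrix.mul_apply, hb₁]
  exact ⟨w', b, Or.inr ⟨hbγ, hw'e⟩, key b (by rw [hbγ, hγe])⟩

theorem FactorsThrough.eq_zero {m n : Type} {α : Matrix m n R} (h : FactorsThrough e 0 α) :
    α = 0 := by
  obtain ⟨U, W, -, -, rfl⟩ := h
  ext i j
  simp [Matrix.mul_apply]

theorem FactorsThrough.exists_quasi_inverse (he : IsSeparating e) {m n : Type} [Fintype m]
    [Fintype n] {r : ℕ} {α : Matrix m n R} (h : FactorsThrough e r α) :
    ∃ β : Matrix n m R, α * β * α = α := by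
  induction r generalizing α with
  | zero => exact ⟨0, by simp [h.eq_zero]⟩
  | succ r ih =>
    obtain ⟨w', b, -, h'⟩ := h.step he
    obtain ⟨β, hβ⟩ := ih h'
    -- With g = w'b this is g + (1 - gα)β(1 - αg), which turns a quasi-inverse β of α - αgα into one
    -- of α.
    refine ⟨w' * b + β - w' * b * α * β - β * α * w' * b + w' * b * α * β * α * w' * b, ?_⟩
    simp only [Matrix.mul_add, Matrix.mul_sub, Matrix.sub_mul, Matrix.add_mul,
      Matrix.mul_assoc] at hβ ⊢
    have h2 := congrArg (fun x => x + α * (w' * (b * α))) hβ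
    simp only [sub_add_cancel] at h2
    conv_rhs => rw [← h2]
    abel

/-- An elimination step with bαw' = e splits off the idempotent αw'bα, which is equivalent to e. The
rest of α is an idempotent orthogonal to it, with one term fewer. -/
theorem FactorsThrough.exists_ofMat_eq (he : IsSeparating e) {n : Type}
    [Fintype n] {r : ℕ} {α : Matrix n n R} (h : FactorsThrough e r α)
    (hα : IsIdempotentElem α) : ∃ s : ℕ, VMonoid.ofMat α hα = s • VMonoid.cls e he.idem := by
  induction r generalizing α with
  | zero =>
    refine ⟨0, ?_⟩
    rw [zero_smul, VMonoid.ofMat_congr h.eq_zero hα IsIdempotentElem.zero, VMonoid.ofMat_zero]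
  | succ r ih =>
    obtain ⟨w', b, hb, h'⟩ := h.step he
    rcases hb with rfl | ⟨hb, hw'⟩
    · simp only [Matrix.zero_mul, Matrix.mul_zero, sub_zero] at h'
      exact ih h' hα
    set G := α * w' * (b * α) with hG
    have h1 : α * G = G := by
      rw [hG, Matrix.mul_assoc α w', ← Matrix.mul_assoc α α, hα.eq]
    have h2 : G * α = G := by
      rw [hG, Matrix.mul_assoc, Matrix.mul_assoc b, hα.eq]
    have h3 : b * α * (α * w') = diagMat e Unit := by
      rw [← Matrix.mul_assoc, Matrix.mul_assoc b, hα.eq, Matrix.mul_assoc, hb]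
    have h4 : IsIdempotentElem G := by
      rw [IsIdempotentElem, hG, Matrix.mul_assoc, ← Matrix.mul_assoc (b * α), h3,
        ← Matrix.mul_assoc, Matrix.mul_assoc α, hw']
    have h5 : IsIdempotentElem (α - G) := by
      rw [IsIdempotentElem, Matrix.mul_sub, Matrix.sub_mul, Matrix.sub_mul, hα.eq, h1, h2, h4.eq]
      abel
    obtain ⟨s, hs⟩ := ih h' h5
    refine ⟨s + 1, ?_⟩
    rw [add_smul, one_smul, ← hs, VMonoid.ofMat_congr (sub_add_cancel α G).symm hα
      (by rw [sub_add_cancel]; exact hα), VMonoid.ofMat_add h5 h4]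
    · congr 1
      rw [VMonoid.cls_eq_ofMat, VMonoid.ofMat_eq_iff]
      exact ⟨α * w', b * α, rfl, h3⟩
    · rw [Matrix.sub_mul, h1, h4.eq, sub_self]
    · rw [Matrix.mul_sub, h2, h4.eq, sub_self]

/-- If `e R e` is one-dimensional, then the multiples of `[e]` are distinct. -/
theorem VMonoid.nsmul_cls_injective (K : Type v) [Field K] [Algebra K R] (he : IsIdempotentElem e)
    (he0 : e ≠ 0) (hK : ∀ a : R, ∃ c : K, e * a * e = c • e) {s t : ℕ}
    (h : s • VMonoid.cls e he = t • VMonoid.cls e he) : s = t := by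
  choose τ hτ using hK
  -- Compressing U and W by e on both sides does not change the products, and the compressed entries
  -- are scalars times e. The matrices of scalars are therefore mutually inverse over K, so they are
  -- square.
  have aux : ∀ (p q : ℕ) (U : Matrix (Fin p) (Fin q) R) (W : Matrix (Fin q) (Fin p) R),
      U * W = diagMat e (Fin p) → W * U = diagMat e (Fin q) → U.map τ * W.map τ = 1 := by
    intro p q U W h1 h2
    have h3 : diagMat e (Fin p) * U * diagMat e (Fin q) *
        (diagMat e (Fin q) * W * diagMat e (Fin p)) = diagMat e (Fin p) := by
      rw [← h1, ← h2]
      have h4 : U * W * (U * W) = U * W := by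
        rw [h1]; exact VMonoid.diagonal_idem he _
      simp only [Matrix.mul_assoc] at h4 ⊢
      simp only [h4]
    ext i j
    have h5 := congrFun (congrFun h3 i) j
    rw [Matrix.mul_apply] at h5
    simp only [Matrix.mul_diagonal, Matrix.diagonal_mul, hτ] at h5
    rw [Matrix.mul_apply, Matrix.one_apply]
    simp only [smul_mul_smul_comm, he.eq, ← Finset.sum_smul, Matrix.diagonal_apply] at h5
    simp only [Matrix.map_apply]
    split_ifs at h5 ⊢
    · have : (∑ k, τ (U i k) * τ (W k j) - 1) • e = 0 := by rw [sub_smul, h5, one_smul, sub_self]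
      exact sub_eq_zero.1 ((smul_eq_zero.1 this).resolve_right he0)
    · exact (smul_eq_zero.1 h5).resolve_right he0
  rw [← VMonoid.ofMat_diagonal, ← VMonoid.ofMat_diagonal, VMonoid.ofMat_eq_iff] at h
  obtain ⟨U, W, h1, h2⟩ := h
  have := Matrix.square_of_invertible _ _ (aux _ _ U W h1 h2) (aux _ _ W U h2 h1)
  simpa using this

end Corner

end

noncomputable section

/-- The elements of `R e R`, written as sums of products. -/
def IsCornerSum {R : Type u} [Ring R] (e a : R) : Prop :=
  ∃ (N : ℕ) (u w : Fin N → R), (∀ k, u k * e = u k) ∧ (∀ k, e * w k = w k) ∧ a = ∑ k, u k * w k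

/-- All terms of all entries serve as one index set. A term of the entry (i, j) gives a column
supported in row i and a row supported in column j. -/
theorem exists_factorsThrough {R : Type u} [Ring R] {e : R} {m n : Type} [Fintype m] [Fintype n]
    {α : Matrix m n R} (h : ∀ i j, IsCornerSum e (α i j)) : ∃ r, FactorsThrough e r α := by
  classical
  choose N u w hu hw h using h
  have := FactorsThrough.of_fintype (e := e) (m := m) (n := n) (ι := Σ s : m × n, Fin (N s.1 s.2))
    (Matrix.of fun i s => if i = s.1.1 then u _ _ s.2 else 0)
    (Matrix.of fun s j => if j = s.1.2 then w _ _ s.2 else 0)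
    (fun i s => by simp only [Matrix.of_apply]; split_ifs <;> simp [hu])
    (fun i s => by simp only [Matrix.of_apply]; split_ifs <;> simp [hw])
  refine ⟨Fintype.card (Σ s : m × n, Fin (N s.1 s.2)), ?_⟩
  convert this using 1
  ext i j
  rw [h, Matrix.mul_apply]
  simp only [Matrix.of_apply]
  rw [Fintype.sum_sigma, Fintype.sum_prod_type, Finset.sum_eq_single i, Finset.sum_eq_single j]
  · simp
  · intro b _ hb
    simp [hb.symm]
  · simp
  · intro b _ hb
    simp [hb.symm]
  · simp

end

/-! ### The structure of `Q₁` -/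

noncomputable section

theorem Q0.closure_induction {K : Type u} [Field K] {P : Q0 K → Prop}
    (scalar : ∀ c, P (algebraMap K _ c)) (hx : P (Q0.x K)) (hy : P (Q0.y K))
    (add : ∀ a b, P a → P b → P (a + b)) (mul : ∀ a b, P a → P b → P (a * b)) (a : Q0 K) :
    P a := by
  obtain ⟨a, rfl⟩ := RingQuot.mkAlgHom_surjective K (ToeplitzRel K) a
  change P (Q0.quot K a)
  induction a using FreeAlgebra.induction with
  | grade0 r => rw [AlgHom.commutes]; exact scalar r
  | grade1 i => rcases i with _ | _ <;> assumption
  | mul a b ha hb => rw [map_mul]; exact mul _ _ ha hb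
  | add a b ha hb => rw [map_add]; exact add _ _ ha hb

namespace Q1

open Polynomial

variable {K : Type u} [Field K]

theorem of_aeval (f : K[X]) :
    UnivLoc.of K (sigmaSet K) (aeval (Q0.x K) f) = aeval (x K) f := by
  rw [← Polynomial.aeval_algHom_apply]; rfl

theorem isUnit_aeval {f : K[X]} (hf : f.eval 0 = 1) : IsUnit (aeval (x K) f) := by
  rw [← of_aeval]
  exact UnivLoc.isUnit_of K _ _ ⟨f, hf, rfl⟩

theorem closure_induction {P : Q1 K → Prop}
    (scalar : ∀ c, P (algebraMap K _ c)) (hx : P (x K)) (hy : P (y K))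
    (inv : ∀ (f : K[X]) (a : Q1 K), f.eval 0 = 1 → a * aeval (x K) f = 1 → P a)
    (add : ∀ a b, P a → P b → P (a + b)) (mul : ∀ a b, P a → P b → P (a * b)) (a : Q1 K) :
    P a := by
  obtain ⟨a, rfl⟩ := RingQuot.mkAlgHom_surjective K (UnivLocRel K (sigmaSet K)) a
  change P (UnivLoc.quot K (sigmaSet K) a)
  induction a using FreeAlgebra.induction with
  | grade0 r => rw [AlgHom.commutes]; exact scalar r
  | grade1 i =>
    rcases i with a | ⟨s, hs⟩
    · change P (UnivLoc.of K (sigmaSet K) a)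
      induction a using Q0.closure_induction with
      | scalar c => rw [AlgHom.commutes]; exact scalar c
      | hx => exact hx
      | hy => exact hy
      | add a b ha hb => rw [map_add]; exact add _ _ ha hb
      | mul a b ha hb => rw [map_mul]; exact mul _ _ ha hb
    · obtain ⟨f, hf, rfl⟩ := id hs
      refine inv f _ hf ?_
      have h := UnivLoc.quot_rel (UnivLocRel.invMul (K := K) (⟨_, hs⟩ : sigmaSet K))
      rw [map_mul, map_one] at h
      rw [← of_aeval]
      exact h
  | mul a b ha hb => rw [map_mul]; exact mul _ _ ha hb
  | add a b ha hb => rw [map_add]; exact add _ _ ha hb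

/-- The elements `g(x) h(x)⁻¹` with `h(0) = 1`. -/
def IsLoc (a : Q1 K) : Prop :=
  ∃ g h : K[X], h.eval 0 = 1 ∧ a * aeval (x K) h = aeval (x K) g

theorem aeval_comm (g h : K[X]) :
    aeval (x K) g * aeval (x K) h = aeval (x K) h * aeval (x K) g := by
  rw [← map_mul, mul_comm, map_mul]

theorem isLoc_aeval (g : K[X]) : IsLoc (aeval (x K) g) := ⟨g, 1, by simp, by simp⟩

theorem isLoc_x : IsLoc (x K) := by simpa using isLoc_aeval (X : K[X])

theorem isLoc_algebraMap (c : K) : IsLoc (algebraMap K (Q1 K) c) := by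
  simpa using isLoc_aeval (C c : K[X])

theorem IsLoc.mul {a b : Q1 K} (ha : IsLoc a) (hb : IsLoc b) : IsLoc (a * b) := by
  obtain ⟨g, h, h0, h1⟩ := ha
  obtain ⟨g', h', h0', h1'⟩ := hb
  refine ⟨g * g', h * h', by simp [h0, h0'], ?_⟩
  rw [map_mul, map_mul, aeval_comm, mul_assoc, ← mul_assoc b, h1', aeval_comm, ← mul_assoc, h1]

theorem IsLoc.add {a b : Q1 K} (ha : IsLoc a) (hb : IsLoc b) : IsLoc (a + b) := by
  obtain ⟨g, h, h0, h1⟩ := ha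
  obtain ⟨g', h', h0', h1'⟩ := hb
  refine ⟨g * h' + g' * h, h * h', by simp [h0, h0'], ?_⟩
  rw [map_add, map_mul, map_mul, map_mul, add_mul, ← mul_assoc, h1, aeval_comm h, ← mul_assoc, h1']

theorem IsLoc.pow {a : Q1 K} (ha : IsLoc a) (n : ℕ) : IsLoc (a ^ n) := by
  induction n with
  | zero => simpa using isLoc_algebraMap (1 : K)
  | succ n ih => rw [pow_succ]; exact ih.mul ha

theorem IsLoc.comm_aeval {a : Q1 K} (ha : IsLoc a) (g : K[X]) :
    a * aeval (x K) g = aeval (x K) g * a := by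
  obtain ⟨g', h, h0, h1⟩ := ha
  refine (isUnit_aeval h0).mul_left_injective ?_
  change a * aeval (x K) g * aeval (x K) h = aeval (x K) g * a * aeval (x K) h
  rw [mul_assoc, aeval_comm, ← mul_assoc, h1, mul_assoc, h1, aeval_comm]

theorem IsLoc.comm_x {a : Q1 K} (ha : IsLoc a) : a * x K = x K * a := by
  simpa using ha.comm_aeval X

theorem exists_isLoc_inv {h : K[X]} (h0 : h.eval 0 = 1) :
    ∃ a, IsLoc a ∧ a * aeval (x K) h = 1 ∧ aeval (x K) h * a = 1 := by
  obtain ⟨⟨s, t, h1, h2⟩, hs⟩ := isUnit_aeval (K := K) h0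
  simp only at hs
  subst hs
  exact ⟨t, ⟨1, h, h0, by rw [h2, map_one]⟩, h2, h1⟩

/-- Splitting off the value c at 0 allows y to be moved to the left: (c + bx)y = yc + b. This rule
underlies the normal form of elements of Q₁. -/
theorem IsLoc.exists_eq_add {a : Q1 K} (ha : IsLoc a) :
    ∃ (c : K) (b : Q1 K), IsLoc b ∧ a = algebraMap K _ c + b * x K := by
  obtain ⟨g, h, h0, h1⟩ := ha
  obtain ⟨t, ht, ht1, ht2⟩ := exists_isLoc_inv (K := K) h0
  have hd : (X : K[X]) ∣ g - C (g.eval 0) * h := by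
    rw [X_dvd_iff, coeff_zero_eq_eval_zero]; simp [h0]
  obtain ⟨k, hk⟩ := hd
  refine ⟨g.eval 0, t * aeval (x K) k, ht.mul (isLoc_aeval k), ?_⟩
  have h2 := congrArg (aeval (x K)) hk
  rw [map_sub, map_mul, map_mul, aeval_C, aeval_X, sub_eq_iff_eq_add] at h2
  have h3 : a = aeval (x K) g * t := by rw [← h1, mul_assoc, ht2, mul_one]
  rw [h3, ← ht.comm_aeval, h2, mul_add, mul_assoc t, ← (isLoc_aeval k).comm_x, add_comm,
    ← mul_assoc t (algebraMap _ _ _), ← Algebra.commutes, mul_assoc _ t, ht1, mul_one]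

/-- Every element of `Q₁` is a sum of elements `yⁱ a` with `a = g(x) h(x)⁻¹`. -/
theorem isLoc_induction {P : Q1 K → Prop} (loc : ∀ a, IsLoc a → P a)
    (add : ∀ a b, P a → P b → P (a + b)) (y_mul : ∀ a, P a → P (y K * a)) (a : Q1 K) : P a := by
  -- Consider the smallest class that contains the elements g(x)h(x)⁻¹ and is closed under sums and
  -- left multiplication by y; membership is expressed by quantifying over all P. The stronger claim
  -- is that left multiplication by any a preserves this class. The case b = 1 gives the statement.
  suffices H : ∀ a (P : Q1 K → Prop), (∀ a, IsLoc a → P a) → (∀ a b, P a → P b → P (a + b)) →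
      (∀ a, P a → P (y K * a)) → (∀ b, (∀ (P : Q1 K → Prop), (∀ a, IsLoc a → P a) →
        (∀ a b, P a → P b → P (a + b)) → (∀ a, P a → P (y K * a)) → P b) → P (a * b)) by
    have := H a P loc add y_mul 1 fun P loc _ _ => loc 1 (by simpa using isLoc_algebraMap (1 : K))
    rwa [mul_one] at this
  clear loc add y_mul P a
  have hloc : ∀ (a : Q1 K), IsLoc a → ∀ (P : Q1 K → Prop), (∀ a, IsLoc a → P a) →
      (∀ a b, P a → P b → P (a + b)) → (∀ a, P a → P (y K * a)) → (∀ b,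
        (∀ (P : Q1 K → Prop), (∀ a, IsLoc a → P a) → (∀ a b, P a → P b → P (a + b)) →
          (∀ a, P a → P (y K * a)) → P b) → P (a * b)) := by
    intro a ha P loc add y_mul b hb
    -- The factor a must vary in the induction, because (c + a'x)yb = y(cb) + a'b involves the new
    -- factors c and a'.
    have h := hb (fun b => P b ∧ ∀ a, IsLoc a → P (a * b))
      (fun b hb => ⟨loc _ hb, fun a ha => loc _ (ha.mul hb)⟩)
      (fun b c hb hc => ⟨add _ _ hb.1 hc.1, fun a ha => by
        rw [mul_add]; exact add _ _ (hb.2 a ha) (hc.2 a ha)⟩)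
      (fun b hb => ⟨y_mul _ hb.1, fun a ha => by
        obtain ⟨c, a', ha', rfl⟩ := ha.exists_eq_add
        have : (algebraMap K _ c + a' * x K) * (y K * b)
            = y K * (algebraMap K _ c * b) + a' * b := by
          rw [add_mul, mul_assoc a', ← mul_assoc (x K), x_mul_y, one_mul, ← mul_assoc,
            Algebra.commutes, mul_assoc]
        rw [this]
        exact add _ _ (y_mul _ (hb.2 _ (isLoc_algebraMap c))) (hb.2 _ ha')⟩)
    exact h.2 a ha
  intro a
  induction a using closure_induction with
  | scalar c => exact hloc _ (isLoc_algebraMap c)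
  | hx => exact hloc _ isLoc_x
  | hy => exact fun P loc add y_mul b hb => y_mul _ (hb P loc add y_mul)
  | inv f a hf ha => exact hloc _ ⟨1, f, hf, by rw [ha, map_one]⟩
  | add a b ha hb =>
    intro P loc add y_mul c hc
    rw [add_mul]
    exact add _ _ (ha P loc add y_mul c hc) (hb P loc add y_mul c hc)
  | mul a b ha hb =>
    intro P loc add y_mul c hc
    rw [mul_assoc]
    exact ha P loc add y_mul _ fun P loc add y_mul => hb P loc add y_mul c hc

theorem x_pow_mul_y_pow (n : ℕ) : x K ^ n * y K ^ n = 1 := by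
  induction n with
  | zero => simp
  | succ n ih =>
    rw [pow_succ, pow_succ', mul_assoc, ← mul_assoc (x K) (y K), x_mul_y, one_mul, ih]

/-- Each x on the left cancels one y, so a high power of x clears all of them. -/
theorem exists_isLoc_x_pow_mul (a : Q1 K) : ∃ N, ∀ M, N ≤ M → IsLoc (x K ^ M * a) := by
  induction a using isLoc_induction with
  | loc a ha => exact ⟨0, fun M _ => (isLoc_x.pow M).mul ha⟩
  | add a b ha hb =>
    obtain ⟨N, hN⟩ := ha
    obtain ⟨N', hN'⟩ := hb
    refine ⟨max N N', fun M hM => ?_⟩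
    rw [mul_add]
    exact (hN M (le_trans (le_max_left _ _) hM)).add (hN' M (le_trans (le_max_right _ _) hM))
  | y_mul a ha =>
    obtain ⟨N, hN⟩ := ha
    refine ⟨N + 1, fun M hM => ?_⟩
    obtain ⟨M, rfl⟩ : ∃ M', M = M' + 1 := ⟨M - 1, by omega⟩
    rw [pow_succ, mul_assoc, ← mul_assoc (x K) (y K), x_mul_y, one_mul]
    exact hN M (by omega)

/-- The idempotent `1 - yx` of `Q₁`. -/
def e (K : Type u) [Field K] : Q1 K := 1 - y K * x K

theorem e_idem : IsIdempotentElem (e K) := Q.idem_aux_one (x_mul_y K)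

theorem x_mul_e : x K * e K = 0 := by
  rw [e, mul_sub, ← mul_assoc, x_mul_y, one_mul, mul_one, sub_self]

theorem e_mul_y : e K * y K = 0 := by
  rw [e, sub_mul, mul_assoc, x_mul_y, one_mul, mul_one, sub_self]

/-- Because ey = 0 and xe = 0, only the constant terms survive between two factors e. -/
theorem exists_e_mul_mul_e (a : Q1 K) : ∃ c : K, e K * a * e K = c • e K := by
  induction a using isLoc_induction with
  | loc a ha =>
    obtain ⟨c, b, -, rfl⟩ := ha.exists_eq_add
    refine ⟨c, ?_⟩
    rw [mul_add, add_mul, ← Algebra.commutes, mul_assoc, e_idem.eq, mul_assoc, mul_assoc b,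
      x_mul_e, mul_zero, mul_zero, add_zero, Algebra.smul_def]
  | add a b ha hb =>
    obtain ⟨c, hc⟩ := ha
    obtain ⟨d, hd⟩ := hb
    exact ⟨c + d, by rw [mul_add, add_mul, hc, hd, add_smul]⟩
  | y_mul a ha => exact ⟨0, by rw [← mul_assoc, e_mul_y]; simp⟩

theorem exists_isLoc_e_mul (a : Q1 K) : ∃ b, IsLoc b ∧ e K * a = e K * b := by
  induction a using isLoc_induction with
  | loc a ha => exact ⟨a, ha, rfl⟩
  | add a b ha hb =>
    obtain ⟨c, hc, hc'⟩ := ha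
    obtain ⟨d, hd, hd'⟩ := hb
    exact ⟨c + d, hc.add hd, by rw [mul_add, mul_add, hc', hd']⟩
  | y_mul a ha =>
    exact ⟨0, by simpa using isLoc_algebraMap (0 : K), by rw [← mul_assoc, e_mul_y]; simp⟩

/-- A nonzero g/h is x^m times an invertible element, and y^m is a right inverse of x^m. -/
theorem IsLoc.exists_right_inverse {a : Q1 K} (ha : IsLoc a) (h : a ≠ 0) : ∃ b, a * b = 1 := by
  obtain ⟨g, d, d0, hd⟩ := ha
  have hg : g ≠ 0 := by
    rintro rfl
    rw [map_zero] at hd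
    exact h ((isUnit_aeval d0).mul_left_eq_zero.1 hd)
  obtain ⟨g', hg', hg0⟩ := Polynomial.exists_eq_pow_rootMultiplicity_mul_and_not_dvd g hg 0
  rw [map_zero, sub_zero] at hg' hg0
  set m := rootMultiplicity 0 g
  have hc : g'.eval 0 ≠ 0 := by
    rwa [X_dvd_iff, coeff_zero_eq_eval_zero] at hg0
  obtain ⟨t, ht, ht1, ht2⟩ := exists_isLoc_inv (K := K) (h := C (g'.eval 0)⁻¹ * g')
    (by simp [hc])
  have h1 : aeval (x K) g * (t * algebraMap K _ (g'.eval 0)⁻¹) = x K ^ m := by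
    rw [hg', map_mul, map_pow, aeval_X, mul_assoc, ← Algebra.commutes, ← mul_assoc _ _ t,
      ← Algebra.commutes, ← aeval_C (x K), ← map_mul, ht2, mul_one]
  exact ⟨aeval (x K) d * (t * algebraMap K _ (g'.eval 0)⁻¹) * y K ^ m, by
    rw [← mul_assoc, ← mul_assoc, hd, h1, x_pow_mul_y_pow]⟩

theorem toRatFunc_aeval (g : K[X]) :
    toRatFunc K (aeval (x K) g) = algebraMap K[X] (RatFunc K) g := by
  rw [← Polynomial.aeval_algHom_apply, toRatFunc_x, ← RatFunc.algebraMap_X,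
    Polynomial.aeval_algebraMap_apply, aeval_X_left_apply]

theorem IsLoc.eq_zero {a : Q1 K} (ha : IsLoc a) (h : toRatFunc K a = 0) : a = 0 := by
  by_contra h0
  obtain ⟨b, hb⟩ := ha.exists_right_inverse h0
  have := congrArg (toRatFunc K) hb
  rw [map_mul, h, zero_mul, map_one] at this
  exact zero_ne_one this

/-- For large M the element x^M a has the form g(x)h(x)⁻¹, and on such elements the map to K(x) is
injective. -/
theorem exists_x_pow_mul_eq_zero {a : Q1 K} (h : toRatFunc K a = 0) :
    ∃ N, ∀ M, N ≤ M → x K ^ M * a = 0 := by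
  obtain ⟨N, hN⟩ := exists_isLoc_x_pow_mul a
  exact ⟨N, fun M hM => (hN M hM).eq_zero (by rw [map_mul, h, mul_zero])⟩

/-- The terms yⁱexⁱ = yⁱxⁱ - yⁱ⁺¹xⁱ⁺¹ telescope. -/
theorem sum_y_pow_mul_e (N : ℕ) (a : Q1 K) :
    a = ∑ i ∈ Finset.range N, y K ^ i * e K * (e K * x K ^ i * a) + y K ^ N * (x K ^ N * a) := by
  induction N with
  | zero => simp
  | succ N ih =>
    conv_lhs => rw [ih]
    rw [Finset.sum_range_succ, add_assoc]
    congr 1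
    have : y K ^ N * e K * (e K * x K ^ N * a) = y K ^ N * e K * (x K ^ N * a) := by
      rw [← mul_assoc, ← mul_assoc, mul_assoc (y K ^ N), e_idem.eq, mul_assoc (y K ^ N * e K)]
    rw [this, e, pow_succ, pow_succ' (x K)]
    noncomm_ring

theorem e_isSeparating : IsSeparating (e K) where
  idem := e_idem
  right a h := by
    obtain ⟨b, hb, hab⟩ := exists_isLoc_e_mul a
    have hb0 : b ≠ 0 := by
      rintro rfl
      exact h (by rw [hab, mul_zero])
    obtain ⟨c, hc⟩ := hb.exists_right_inverse hb0
    exact ⟨c * e K, by rw [hab, mul_assoc, ← mul_assoc b, hc, one_mul, e_idem.eq]⟩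
  left a h := by
    by_contra! hcon
    obtain ⟨N, hN⟩ := exists_isLoc_x_pow_mul a
    -- Writing x^N a = c + bx, one more factor x gives x(c + bx)e = cxe = 0. The expansion of ae is
    -- then a finite sum of terms yⁱe(exⁱae) with exⁱae = ce. A nonzero c would provide the missing
    -- b, and if every c vanishes then ae = 0.
    have h1 : x K ^ (N + 1) * (a * e K) = 0 := by
      obtain ⟨c, b, -, hb⟩ := (hN N le_rfl).exists_eq_add
      rw [pow_succ', mul_assoc, ← mul_assoc _ a, hb, add_mul, mul_assoc b, x_mul_e, mul_zero,
        add_zero, ← mul_assoc, ← Algebra.commutes, mul_assoc, x_mul_e, mul_zero]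
    apply h
    rw [sum_y_pow_mul_e (N + 1) (a * e K), h1, mul_zero, add_zero]
    refine Finset.sum_eq_zero fun i _ => ?_
    obtain ⟨c, hc⟩ := exists_e_mul_mul_e (x K ^ i * a)
    have h2 : e K * x K ^ i * (a * e K) = c • e K := by
      rw [← hc]; simp only [mul_assoc]
    rw [h2]
    by_cases hc0 : c = 0
    · rw [hc0, zero_smul, mul_zero]
    · refine absurd ?_ (hcon (c⁻¹ • (e K * x K ^ i)))
      rw [smul_mul_assoc, smul_mul_assoc, mul_assoc _ a, h2, smul_smul, inv_mul_cancel₀ hc0,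
        one_smul]

end Q1

end

/-! ### The kernel of `Q → K(x)` and the regularity of `Q` -/

noncomputable section

namespace Q

open Polynomial

variable {K : Type u} [Field K]

theorem Q1_toRatFunc_surjective : Function.Surjective (Q1.toRatFunc K) := by
  intro f
  induction f using RatFunc.induction_on with
  | f g h hh =>
    have h0 : aeval (Q1.x K) h ≠ 0 := by
      intro h1
      have h2 := Q1.toRatFunc_aeval h
      rw [h1, map_zero] at h2
      exact RatFunc.algebraMap_ne_zero hh h2.symm
    obtain ⟨b, hb⟩ := (Q1.isLoc_aeval h).exists_right_inverse h0
    refine ⟨aeval (Q1.x K) g * b, ?_⟩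
    have h2 := congrArg (Q1.toRatFunc K) hb
    rw [map_mul, map_one, Q1.toRatFunc_aeval] at h2
    rw [map_mul, Q1.toRatFunc_aeval, eq_div_iff (RatFunc.algebraMap_ne_zero hh), mul_assoc,
      mul_comm _ (algebraMap _ _ h), h2, mul_one]

variable (K) in
/-- The quotient map `Q → K(x)`. -/
def toRatFunc : Q K →ₐ[K] RatFunc K :=
  ((Q1.toRatFunc K).comp (AlgHom.fst K (Q1 K) (Q1 K)ᵐᵒᵖ)).comp (pullbackQ K).val

theorem toRatFunc_fst (a : Q K) : Q1.toRatFunc K a.1.1 = toRatFunc K a := rfl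

theorem toRatFunc_snd (a : Q K) : Q1.toRatFunc K a.1.2.unop = toRatFunc K a := by
  rw [← toRatFunc_fst, ← Q1.opToRatFunc_op, MulOpposite.op_unop]
  exact ((mem_iff K _).1 a.2).symm

theorem toRatFunc_surjective : Function.Surjective (toRatFunc K) := by
  intro f
  obtain ⟨a, ha⟩ := Q1_toRatFunc_surjective f
  exact ⟨⟨(a, MulOpposite.op a), rfl⟩, ha⟩

/-- A pair of elements in the kernel of `Q₁ → K(x)`, as an element of `Q`. -/
def ofKer (a b : Q1 K) (ha : Q1.toRatFunc K a = 0) (hb : Q1.toRatFunc K b = 0) : Q K :=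
  ⟨(a, MulOpposite.op b), by rw [mem_iff, ha, Q1.opToRatFunc_op, hb]⟩

@[ext]
theorem ext {a b : Q K} (h1 : a.1.1 = b.1.1) (h2 : a.1.2.unop = b.1.2.unop) : a = b :=
  Subtype.ext (Prod.ext h1 (MulOpposite.unop_injective h2))

@[simp] theorem fst_mul (a b : Q K) : (a * b).1.1 = a.1.1 * b.1.1 := rfl
@[simp] theorem snd_mul (a b : Q K) : (a * b).1.2.unop = b.1.2.unop * a.1.2.unop := rfl
@[simp] theorem fst_add (a b : Q K) : (a + b).1.1 = a.1.1 + b.1.1 := rfl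
@[simp] theorem snd_add (a b : Q K) : (a + b).1.2.unop = a.1.2.unop + b.1.2.unop := rfl
@[simp] theorem fst_zero : (0 : Q K).1.1 = 0 := rfl
@[simp] theorem snd_zero : (0 : Q K).1.2.unop = 0 := rfl
@[simp] theorem fst_one : (1 : Q K).1.1 = 1 := rfl
@[simp] theorem snd_one : (1 : Q K).1.2.unop = 1 := rfl
@[simp] theorem fst_ofKer (a b : Q1 K) (ha hb) : (ofKer a b ha hb).1.1 = a := rfl
@[simp] theorem snd_ofKer (a b : Q1 K) (ha hb) : (ofKer a b ha hb).1.2.unop = b := rfl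
@[simp] theorem fst_e₁ : (e₁ K).1.1 = 0 := rfl
@[simp] theorem snd_e₁ : (e₁ K).1.2.unop = Q1.e K := rfl
@[simp] theorem fst_e₂ : (e₂ K).1.1 = Q1.e K := rfl
@[simp] theorem snd_e₂ : (e₂ K).1.2.unop = 0 := rfl
@[simp] theorem snd_p (n : ℕ) : (p K n).1.2.unop = 1 := rfl
@[simp] theorem fst_q (n : ℕ) : (q K n).1.1 = 1 := rfl

theorem Q1_toRatFunc_e : Q1.toRatFunc K (Q1.e K) = 0 := by
  rw [Q1.e, map_sub, map_mul, Q1.toRatFunc_x, Q1.toRatFunc_y,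
    inv_mul_cancel₀ RatFunc.X_ne_zero, map_one, sub_self]

theorem e₂_isSeparating : IsSeparating (e₂ K) where
  idem := e₂_idem K
  left a h := by
    have h1 : a.1.1 * Q1.e K ≠ 0 := fun h2 => h (by ext <;> simp [h2])
    obtain ⟨b, hb⟩ := Q1.e_isSeparating.left _ h1
    refine ⟨ofKer (Q1.e K * b) 0 (by rw [map_mul, Q1_toRatFunc_e, zero_mul]) (map_zero _), ?_⟩
    ext
    · simp only [fst_mul, fst_ofKer, fst_e₂]
      rw [mul_assoc, mul_assoc, ← mul_assoc b, hb, Q1.e_idem.eq]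
    · simp
  right a h := by
    have h1 : Q1.e K * a.1.1 ≠ 0 := fun h2 => h (by ext <;> simp [h2])
    obtain ⟨b, hb⟩ := Q1.e_isSeparating.right _ h1
    refine ⟨ofKer (b * Q1.e K) 0 (by rw [map_mul, Q1_toRatFunc_e, mul_zero]) (map_zero _), ?_⟩
    ext
    · simp only [fst_mul, fst_ofKer, fst_e₂]
      rw [← mul_assoc, hb, Q1.e_idem.eq]
    · simp

/-- The second coordinate multiplies in the opposite order, so the left and right conditions for
`Q1.e` change places. -/
theorem e₁_isSeparating : IsSeparating (e₁ K) where
  idem := e₁_idem K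
  left a h := by
    have h1 : Q1.e K * a.1.2.unop ≠ 0 := fun h2 => h (by ext <;> simp [h2])
    obtain ⟨b, hb⟩ := Q1.e_isSeparating.right _ h1
    refine ⟨ofKer 0 (b * Q1.e K) (map_zero _) (by rw [map_mul, Q1_toRatFunc_e, mul_zero]), ?_⟩
    ext
    · simp
    · simp only [snd_mul, snd_ofKer, snd_e₁]
      rw [← mul_assoc, ← mul_assoc, hb, Q1.e_idem.eq]
  right a h := by
    have h1 : a.1.2.unop * Q1.e K ≠ 0 := fun h2 => h (by ext <;> simp [h2])
    obtain ⟨b, hb⟩ := Q1.e_isSeparating.left _ h1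
    refine ⟨ofKer 0 (Q1.e K * b) (map_zero _) (by rw [map_mul, Q1_toRatFunc_e, zero_mul]), ?_⟩
    ext
    · simp
    · simp only [snd_mul, snd_ofKer, snd_e₁]
      rw [mul_assoc, ← mul_assoc b, hb, Q1.e_idem.eq]

theorem fst_sum {ι : Type*} (s : Finset ι) (f : ι → Q K) :
    (∑ i ∈ s, f i).1.1 = ∑ i ∈ s, (f i).1.1 :=
  map_sum ((AlgHom.fst K (Q1 K) (Q1 K)ᵐᵒᵖ).comp (pullbackQ K).val) f s

theorem snd_sum {ι : Type*} (s : Finset ι) (f : ι → Q K) :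
    (∑ i ∈ s, f i).1.2.unop = ∑ i ∈ s, (f i).1.2.unop := by
  classical
  induction s using Finset.induction_on with
  | empty => simp
  | insert a s ha ih => rw [Finset.sum_insert ha, Finset.sum_insert ha, snd_add, ih]

/-- The remainder in `Q1.sum_y_pow_mul_e` vanishes as soon as x^N a = 0. -/
theorem isCornerSum_e₂ {a : Q1 K} (ha : Q1.toRatFunc K a = 0) :
    IsCornerSum (e₂ K) (ofKer a 0 ha (map_zero _)) := by
  obtain ⟨N, hN⟩ := Q1.exists_x_pow_mul_eq_zero ha
  refine ⟨N, fun k => ofKer (Q1.y K ^ (k : ℕ) * Q1.e K) 0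
      (by rw [map_mul, Q1_toRatFunc_e, mul_zero]) (map_zero _),
    fun k => ofKer (Q1.e K * Q1.x K ^ (k : ℕ) * a) 0
      (by rw [map_mul, ha, mul_zero]) (map_zero _), fun k => ?_, fun k => ?_, ?_⟩
  · ext
    · simp [mul_assoc, Q1.e_idem.eq]
    · simp
  · ext
    · simp [← mul_assoc, Q1.e_idem.eq]
    · simp
  · ext
    · conv_lhs => rw [fst_ofKer, Q1.sum_y_pow_mul_e N a, hN N le_rfl, mul_zero, add_zero]
      rw [fst_sum, Finset.sum_range]
      simp
    · rw [snd_sum]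
      simp

theorem isCornerSum_e₁ {a : Q1 K} (ha : Q1.toRatFunc K a = 0) :
    IsCornerSum (e₁ K) (ofKer 0 a (map_zero _) ha) := by
  obtain ⟨N, hN⟩ := Q1.exists_x_pow_mul_eq_zero ha
  refine ⟨N, fun k => ofKer 0 (Q1.e K * Q1.x K ^ (k : ℕ) * a) (map_zero _)
      (by rw [map_mul, ha, mul_zero]),
    fun k => ofKer 0 (Q1.y K ^ (k : ℕ) * Q1.e K) (map_zero _)
      (by rw [map_mul, Q1_toRatFunc_e, mul_zero]), fun k => ?_, fun k => ?_, ?_⟩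
  · ext
    · simp
    · simp [← mul_assoc, Q1.e_idem.eq]
  · ext
    · simp
    · simp [mul_assoc, Q1.e_idem.eq]
  · ext
    · rw [fst_sum]
      simp
    · conv_lhs => rw [snd_ofKer, Q1.sum_y_pow_mul_e N a, hN N le_rfl, mul_zero, add_zero]
      rw [snd_sum, Finset.sum_range]
      simp

theorem exists_quasi_inverse_of_isCornerSum {R : Type u} [Ring R] {e a : R} (he : IsSeparating e)
    (h : IsCornerSum e a) : ∃ b, a * b * a = a := by
  obtain ⟨r, hr⟩ := exists_factorsThrough (e := e) (α := Matrix.of fun _ _ : Unit => a)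
    fun _ _ => h
  obtain ⟨β, hβ⟩ := hr.exists_quasi_inverse he
  refine ⟨β () (), ?_⟩
  simpa [Matrix.mul_apply] using congrFun (congrFun hβ ()) ()

theorem exists_quasi_inverse_of_ker {a : Q K} (ha : toRatFunc K a = 0) :
    ∃ b, a * b * a = a := by
  have h1 : Q1.toRatFunc K a.1.1 = 0 := ha
  have h2 : Q1.toRatFunc K a.1.2.unop = 0 := by rw [toRatFunc_snd, ha]
  obtain ⟨b, hb⟩ := exists_quasi_inverse_of_isCornerSum e₂_isSeparating (isCornerSum_e₂ h1)
  obtain ⟨c, hc⟩ := exists_quasi_inverse_of_isCornerSum e₁_isSeparating (isCornerSum_e₁ h2)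
  have hb' : a.1.1 * b.1.1 * a.1.1 = a.1.1 := congrArg (fun q : Q K => q.1.1) hb
  have hc' : a.1.2.unop * (c.1.2.unop * a.1.2.unop) = a.1.2.unop :=
    congrArg (fun q : Q K => q.1.2.unop) hc
  -- Replacing b by bab keeps it a quasi-inverse and puts it into the kernel, where the two
  -- coordinates can be chosen independently.
  refine ⟨ofKer (b.1.1 * a.1.1 * b.1.1) (c.1.2.unop * a.1.2.unop * c.1.2.unop)
    (by rw [map_mul, map_mul, h1, mul_zero, zero_mul])
    (by rw [map_mul, map_mul, h2, mul_zero, zero_mul]), ?_⟩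
  ext
  · simp only [fst_mul, fst_ofKer]
    rw [← mul_assoc, ← mul_assoc, hb', hb']
  · simp only [snd_mul, snd_ofKer]
    rw [mul_assoc (c.1.2.unop * _), mul_assoc, hc', hc']

theorem isVNRegular : IsVNRegular (Q K) := by
  intro a
  obtain ⟨b, hb⟩ := toRatFunc_surjective (toRatFunc K a)⁻¹
  obtain ⟨c, hc⟩ : ∃ c, (a - a * b * a) * c * (a - a * b * a) = a - a * b * a := by
    refine exists_quasi_inverse_of_ker ?_
    rw [map_sub, map_mul, map_mul, hb]
    by_cases h : toRatFunc K a = 0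
    · rw [h]; simp
    · rw [mul_inv_cancel₀ h, one_mul, sub_self]
  -- The witness is b + (1 - ba)c(1 - ab), where c is a quasi-inverse of the kernel element a - aba.
  refine ⟨b + c - b * a * c - c * a * b + b * a * c * a * b, ?_⟩
  have : a * (b + c - b * a * c - c * a * b + b * a * c * a * b) * a =
      a * b * a + (a - a * b * a) * c * (a - a * b * a) := by
    simp only [mul_add, mul_sub, sub_mul, add_mul, mul_assoc]
    abel
  rw [this, hc]
  abel

variable (K) in
/-- The element `(x, x)` of `Q`. -/
def X : Q K := ⟨(Q1.x K, ox K), rfl⟩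

variable (K) in
/-- The element `(y, y)` of `Q`. -/
def Y : Q K := ⟨(Q1.y K, oy K), rfl⟩

theorem Y_pow_mul_X_pow (n : ℕ) : Y K ^ n * X K ^ n = p K n := by
  ext
  · rfl
  · exact Q1.x_pow_mul_y_pow n

theorem X_pow_mul_Y_pow (n : ℕ) : X K ^ n * Y K ^ n = q K n := by
  ext
  · exact Q1.x_pow_mul_y_pow n
  · rfl

theorem cls_p_eq_cls_q (n : ℕ) :
    VMonoid.cls (p K n) (p_idem K n) = VMonoid.cls (q K n) (q_idem K n) :=
  VMonoid.cls_eq_cls _ _ _ _ (Y_pow_mul_X_pow n) (X_pow_mul_Y_pow n)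

/-- In Q₁, powers of x kill kernel elements from the left. In the opposite coordinate this is the
effect of the right factor, so X is needed on both sides. -/
theorem exists_X_pow_mul_mul_X_pow {a : Q K} (h : toRatFunc K a = 0) :
    ∃ N, ∀ M, N ≤ M → X K ^ M * a * X K ^ M = 0 := by
  obtain ⟨N, hN⟩ := Q1.exists_x_pow_mul_eq_zero (a := a.1.1) h
  obtain ⟨N', hN'⟩ := Q1.exists_x_pow_mul_eq_zero (a := a.1.2.unop) (by rw [toRatFunc_snd, h])
  refine ⟨max N N', fun M hM => ?_⟩
  ext
  · change Q1.x K ^ M * a.1.1 * Q1.x K ^ M = 0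
    rw [hN M (le_trans (le_max_left _ _) hM), zero_mul]
  · change Q1.x K ^ M * (a.1.2.unop * Q1.x K ^ M) = 0
    rw [← mul_assoc, hN' M (le_trans (le_max_right _ _) hM), zero_mul]

end Q

end

/-! ### Decomposition of idempotent matrices over `Q` -/

noncomputable section

namespace Q

variable {K : Type u} [Field K]

/-- The two coordinates of E, each completed by zero, are orthogonal idempotents E₁ and E₂ with sum
E, and elimination applies to each. -/
theorem exists_ofMat_eq_of_ker {n : Type} [Fintype n] {E : Matrix n n (Q K)}
    (hE : IsIdempotentElem E) (h : ∀ i j, toRatFunc K (E i j) = 0) :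
    ∃ a b : ℕ, VMonoid.ofMat E hE =
      a • VMonoid.cls (e₁ K) (e₁_idem K) + b • VMonoid.cls (e₂ K) (e₂_idem K) := by
  have h2 : ∀ i j, Q1.toRatFunc K (E i j).1.2.unop = 0 := fun i j => by rw [toRatFunc_snd, h]
  set E₂ : Matrix n n (Q K) := Matrix.of fun i j => ofKer (E i j).1.1 0 (h i j) (map_zero _)
    with hE₂
  set E₁ : Matrix n n (Q K) := Matrix.of fun i j => ofKer 0 (E i j).1.2.unop (map_zero _) (h2 i j)
    with hE₁
  have a11 : ∀ i j, (E₁ i j).1.1 = 0 := fun _ _ => rfl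
  have a12 : ∀ i j, (E₁ i j).1.2.unop = (E i j).1.2.unop := fun _ _ => rfl
  have a21 : ∀ i j, (E₂ i j).1.1 = (E i j).1.1 := fun _ _ => rfl
  have a22 : ∀ i j, (E₂ i j).1.2.unop = 0 := fun _ _ => rfl
  have hsum : E = E₁ + E₂ := by
    ext i j <;> simp [a11, a12, a21, a22]
  have hmul1 : ∀ i j, ∑ k, (E i k).1.1 * (E k j).1.1 = (E i j).1.1 := fun i j => by
    conv_rhs => rw [← hE.eq, Matrix.mul_apply, fst_sum]
    rfl
  have hmul2 : ∀ i j, ∑ k, (E k j).1.2.unop * (E i k).1.2.unop = (E i j).1.2.unop := fun i j => by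
    conv_rhs => rw [← hE.eq, Matrix.mul_apply, snd_sum]
    rfl
  have i1 : IsIdempotentElem E₁ := by
    ext i j
    · rw [Matrix.mul_apply, fst_sum]
      simp [a11]
    · rw [Matrix.mul_apply, snd_sum]
      simp [a12, hmul2]
  have i2 : IsIdempotentElem E₂ := by
    ext i j
    · rw [Matrix.mul_apply, fst_sum]
      simp [a21, hmul1]
    · rw [Matrix.mul_apply, snd_sum]
      simp [a22]
  have h12 : E₁ * E₂ = 0 := by
    ext i j
    · rw [Matrix.mul_apply, fst_sum]
      simp [a11, a21]
    · rw [Matrix.mul_apply, snd_sum]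
      simp [a12, a22]
  have h21 : E₂ * E₁ = 0 := by
    ext i j
    · rw [Matrix.mul_apply, fst_sum]
      simp [a11, a21]
    · rw [Matrix.mul_apply, snd_sum]
      simp [a12, a22]
  obtain ⟨r, hr⟩ := exists_factorsThrough (e := e₁ K) (α := E₁) fun i j => isCornerSum_e₁ (h2 i j)
  obtain ⟨s, hs⟩ := exists_factorsThrough (e := e₂ K) (α := E₂) fun i j => isCornerSum_e₂ (h i j)
  obtain ⟨a, ha⟩ := hr.exists_ofMat_eq e₁_isSeparating i1
  obtain ⟨b, hb⟩ := hs.exists_ofMat_eq e₂_isSeparating i2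
  exact ⟨a, b, by
    rw [VMonoid.ofMat_congr hsum hE (hsum ▸ hE), VMonoid.ofMat_add i1 i2 h12 h21, ha, hb]⟩

theorem one_isSeparating (F : Type u) [Field F] : IsSeparating (1 : F) where
  idem := IsIdempotentElem.one
  left a h := ⟨a⁻¹, by rw [mul_one] at h; rw [mul_one, inv_mul_cancel₀ h]⟩
  right a h := ⟨a⁻¹, by rw [one_mul] at h; rw [one_mul, mul_inv_cancel₀ h]⟩

theorem exists_matEquiv_one {F : Type u} [Field F] {n : Type} [Fintype n] {E : Matrix n n F}
    (hE : IsIdempotentElem E) :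
    ∃ k : ℕ, MatEquiv E (1 : Matrix (Fin k) (Fin k) F) := by
  obtain ⟨r, hr⟩ := exists_factorsThrough (e := (1 : F)) (α := E)
    fun i j => ⟨1, fun _ => E i j, fun _ => 1, by simp, by simp, by simp⟩
  obtain ⟨k, hk⟩ := hr.exists_ofMat_eq (one_isSeparating F) hE
  rw [← VMonoid.ofMat_diagonal, VMonoid.ofMat_eq_iff, Matrix.diagonal_one] at hk
  exact ⟨k, hk⟩

theorem toRatFunc_X_mul_Y (n : ℕ) : toRatFunc K (X K ^ n * Y K ^ n) = 1 := by
  rw [X_pow_mul_Y_pow, ← toRatFunc_fst, fst_q, map_one]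

theorem diagMat_mul_map {m n : Type} [Fintype m] [Fintype n] [DecidableEq m]
    (a : Q K) (M : Matrix m n (Q K)) : (diagMat a m * M).map (toRatFunc K) =
      toRatFunc K a • M.map (toRatFunc K) := by
  ext i j
  simp [Matrix.diagonal_mul]

theorem mul_diagMat_map {m n : Type} [Fintype m] [Fintype n] [DecidableEq n]
    (a : Q K) (M : Matrix m n (Q K)) : (M * diagMat a n).map (toRatFunc K) =
      toRatFunc K a • M.map (toRatFunc K) := by
  ext i j
  simp [Matrix.mul_diagonal, mul_comm]

theorem exists_ofMat_eq {n : Type} [Fintype n] {E : Matrix n n (Q K)}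
    (hE : IsIdempotentElem E) :
    ∃ k N a b : ℕ, VMonoid.ofMat E hE = k • VMonoid.cls (p K (N + 1)) (p_idem K (N + 1)) +
      (a • VMonoid.cls (e₁ K) (e₁_idem K) + b • VMonoid.cls (e₂ K) (e₂_idem K)) := by
  classical
  obtain ⟨k, u, v, huv, hvu⟩ := exists_matEquiv_one
    (VMonoid.map_idem (toRatFunc K : Q K →+* RatFunc K) hE)
  have hmul : ∀ {m n p : Type} [Fintype n] (A : Matrix m n (Q K)) (B : Matrix n p (Q K)),
      (A * B).map (toRatFunc K) = A.map (toRatFunc K) * B.map (toRatFunc K) :=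
    fun A B => Matrix.map_mul (f := (toRatFunc K : Q K →+* RatFunc K))
  choose s hs using toRatFunc_surjective (K := K)
  have hmap : ∀ {m n : Type} (A : Matrix m n (RatFunc K)),
      (A.map s).map (toRatFunc K) = A := fun A => by ext i j; simp [hs]
  have hEuv : E.map (toRatFunc K) = u * v := huv.symm
  -- U and W lift the equivalence between the image of E and the identity of size k, so WU - 1 has
  -- entries in the kernel.
  set U := E * u.map s with hU
  set W := v.map s * E with hW
  have hEU : E * U = U := by rw [hU, ← Matrix.mul_assoc, hE.eq]
  have hWE : W * E = W := by rw [hW, Matrix.mul_assoc, hE.eq]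
  have hUm : U.map (toRatFunc K) = u := by
    rw [hU, hmul, hmap, hEuv, Matrix.mul_assoc, hvu, Matrix.mul_one]
  have hWm : W.map (toRatFunc K) = v := by
    rw [hW, hmul, hmap, hEuv, ← Matrix.mul_assoc, hvu, Matrix.one_mul]
  have hWU : (W * U).map (toRatFunc K) = 1 := by rw [hmul, hUm, hWm, hvu]
  have hj : ∀ i j, toRatFunc K ((W * U - 1 : Matrix (Fin k) (Fin k) (Q K)) i j) = 0 := fun i j => by
    have := congrFun (congrFun hWU i) j
    rw [Matrix.map_apply] at this
    rw [Matrix.sub_apply, map_sub, this, Matrix.one_apply, Matrix.one_apply]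
    split_ifs <;> simp
  choose N hN using fun i j => exists_X_pow_mul_mul_X_pow (hj i j)
  -- One exponent serves all entries. It is taken positive so that L + L is a successor, because x̄ₙ
  -- corresponds to p (n+1).
  obtain ⟨M, hM⟩ : ∃ M, ∀ i j, X K ^ (M + 1) * (W * U - 1 : Matrix (Fin k) (Fin k) (Q K)) i j * X K ^ (M + 1) = 0 :=
    ⟨∑ i, ∑ j, N i j, fun i j => hN i j _ <| Nat.le_succ_of_le <|
      (Finset.single_le_sum (f := fun j => N i j) (fun _ _ => Nat.zero_le _)
        (Finset.mem_univ j)).trans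
      (Finset.single_le_sum (f := fun i => ∑ j, N i j) (fun _ _ => Nat.zero_le _)
        (Finset.mem_univ i))⟩
  set L := M + 1
  set D := diagMat (X K ^ L) (Fin k) with hD
  have hDD : D * (W * U) * D = diagMat (X K ^ (L + L)) (Fin k) := by
    have h0 : D * (W * U - 1) * D = 0 := by
      ext1 i j
      rw [Matrix.mul_diagonal, Matrix.diagonal_mul, hM, Matrix.zero_apply]
    rw [Matrix.mul_sub, Matrix.sub_mul, sub_eq_zero, Matrix.mul_one] at h0
    rw [h0, hD, Matrix.diagonal_mul_diagonal, ← pow_add]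
  set P := diagMat (p K (L + L)) (Fin k) with hP
  have hPi : IsIdempotentElem P := VMonoid.diagonal_idem (p_idem K _) _
  set Z := diagMat (Y K ^ (L + L)) (Fin k) with hZ
  -- From D(WU)D = X^(2L) and Y^(2L)X^(2L) = p (2L) it follows that BA = P. Hence AB is an
  -- idempotent below E and equivalent to P.
  set B := P * Z * D * W with hB
  set A := U * D * P with hA
  have hBA : B * A = P := by
    have h1 : B * A = P * (Z * (D * (W * U) * D)) * P := by
      rw [hB, hA]; simp only [Matrix.mul_assoc]
    rw [h1, hDD, hZ, Matrix.diagonal_mul_diagonal, Y_pow_mul_X_pow]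
    change P * P * P = P
    rw [hPi.eq, hPi.eq]
  have hAP : A * P = A := by rw [hA, Matrix.mul_assoc, hPi.eq]
  have hEA : E * A = A := by rw [hA, ← Matrix.mul_assoc, ← Matrix.mul_assoc, hEU]
  have hBE : B * E = B := by rw [hB, Matrix.mul_assoc, hWE]
  have hG : IsIdempotentElem (A * B) := by
    rw [IsIdempotentElem, Matrix.mul_assoc, ← Matrix.mul_assoc B, hBA, ← Matrix.mul_assoc, hAP]
  have hEG : E * (A * B) = A * B := by rw [← Matrix.mul_assoc, hEA]
  have hGE : A * B * E = A * B := by rw [Matrix.mul_assoc, hBE]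
  have hH : IsIdempotentElem (E - A * B) := by
    rw [IsIdempotentElem, Matrix.mul_sub, Matrix.sub_mul, Matrix.sub_mul, hE.eq, hEG, hGE, hG.eq]
    abel
  -- AB and E agree over K(x), so E - AB is an idempotent over the kernel.
  have hGm : (A * B).map (toRatFunc K) = E.map (toRatFunc K) := by
    have hp : toRatFunc K (p K (L + L)) = 1 := toRatFunc_yx K (L + L)
    rw [hmul, hA, hB, mul_diagMat_map, mul_diagMat_map, Matrix.mul_assoc, Matrix.mul_assoc,
      diagMat_mul_map, diagMat_mul_map, diagMat_mul_map, hUm, hWm, hp, hEuv, one_smul, one_smul,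
      Matrix.smul_mul, Matrix.mul_smul, Matrix.mul_smul, smul_smul, smul_smul, ← map_mul,
      ← map_mul]
    have h2 : toRatFunc K (X K ^ L * Y K ^ (L + L) * X K ^ L) = 1 := by
      rw [map_mul, map_mul, mul_right_comm, ← map_mul, ← pow_add, ← map_mul, toRatFunc_X_mul_Y]
    rw [h2, one_smul]
  obtain ⟨a, b, hab⟩ := exists_ofMat_eq_of_ker hH fun i j => by
    have := congrFun (congrFun hGm i) j
    rw [Matrix.map_apply, Matrix.map_apply] at this
    rw [Matrix.sub_apply, map_sub, this, sub_self]
  refine ⟨k, L + M, a, b, ?_⟩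
  rw [← hab, ← VMonoid.ofMat_diagonal, VMonoid.ofMat_congr (add_sub_cancel (A * B) E).symm hE
    (by rw [add_sub_cancel]; exact hE), VMonoid.ofMat_add hG hH]
  · congr 1
    rw [VMonoid.ofMat_eq_iff]
    exact ⟨A, B, rfl, hBA⟩
  · rw [Matrix.mul_sub, hGE, hG.eq, sub_self]
  · rw [Matrix.sub_mul, hEG, hG.eq, sub_self]

end Q

end

/-! ### Linear maps of finite rank -/

noncomputable section

/-- Linear maps with finite-dimensional range. -/
def IsFinRank {K : Type*} [Field K] {V W : Type*} [AddCommGroup V] [Module K V] [AddCommGroup W]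
    [Module K W] (f : V →ₗ[K] W) : Prop :=
  FiniteDimensional K (LinearMap.range f)

namespace IsFinRank

variable {K : Type*} [Field K] {V W Z : Type*} [AddCommGroup V] [Module K V] [AddCommGroup W]
  [Module K W] [AddCommGroup Z] [Module K Z]

theorem of_range_le {f : V →ₗ[K] W} (s : Submodule K W) [FiniteDimensional K s]
    (h : LinearMap.range f ≤ s) : IsFinRank f :=
  Submodule.finiteDimensional_of_le h

theorem zero : IsFinRank (0 : V →ₗ[K] W) := of_range_le ⊥ (by simp)

theorem add {f g : V →ₗ[K] W} (hf : IsFinRank f) (hg : IsFinRank g) : IsFinRank (f + g) := by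
  have : FiniteDimensional K (LinearMap.range f) := hf
  have : FiniteDimensional K (LinearMap.range g) := hg
  exact of_range_le (LinearMap.range f ⊔ LinearMap.range g) (LinearMap.range_add_le f g)

theorem comp_left {f : V →ₗ[K] W} (hf : IsFinRank f) (g : W →ₗ[K] Z) : IsFinRank (g ∘ₗ f) := by
  have : FiniteDimensional K (LinearMap.range f) := hf
  exact of_range_le ((LinearMap.range f).map g) (LinearMap.range_comp f g).le

theorem comp_right {f : V →ₗ[K] W} (hf : IsFinRank f) (g : Z →ₗ[K] V) : IsFinRank (f ∘ₗ g) := by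
  have : FiniteDimensional K (LinearMap.range f) := hf
  exact of_range_le (LinearMap.range f) (LinearMap.range_comp_le_range g f)

theorem neg {f : V →ₗ[K] W} (hf : IsFinRank f) : IsFinRank (-f) := by
  simpa using hf.comp_left (-LinearMap.id)

theorem sub {f g : V →ₗ[K] W} (hf : IsFinRank f) (hg : IsFinRank g) : IsFinRank (f - g) := by
  rw [sub_eq_add_neg]; exact hf.add hg.neg

theorem sum {ι : Type*} (s : Finset ι) {f : ι → V →ₗ[K] W} (hf : ∀ i ∈ s, IsFinRank (f i)) :
    IsFinRank (∑ i ∈ s, f i) := by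
  classical
  induction s using Finset.induction_on with
  | empty => simpa using zero
  | insert a s ha ih =>
    rw [Finset.sum_insert ha]
    exact (hf a (by simp)).add (ih fun i hi => hf i (by simp [hi]))

end IsFinRank

/-! ### The splitting of `K(x)` into polar and regular parts at 0 -/

namespace RatFuncSplit

open Polynomial

variable (K : Type u) [Field K]

/-- The local ring of rational functions that are regular at `0`. -/
def regular : Subalgebra K (RatFunc K) where
  carrier := {f | ∃ g h : K[X], h.eval 0 = 1 ∧ f * algebraMap K[X] (RatFunc K) h =
    algebraMap K[X] (RatFunc K) g}
  mul_mem' := by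
    rintro a b ⟨g, h, h0, h1⟩ ⟨g', h', h0', h1'⟩
    exact ⟨g * g', h * h', by simp [h0, h0'], by rw [map_mul, map_mul, ← h1, ← h1']; ring⟩
  add_mem' := by
    rintro a b ⟨g, h, h0, h1⟩ ⟨g', h', h0', h1'⟩
    exact ⟨g * h' + g' * h, h * h', by simp [h0, h0'], by
      rw [map_add, map_mul, map_mul, map_mul, ← h1, ← h1']; ring⟩
  algebraMap_mem' c := ⟨C c, 1, by simp, by
    rw [map_one, mul_one, RatFunc.algebraMap_C]; rfl⟩

variable {K}

theorem algebraMap_mem (g : K[X]) : algebraMap K[X] (RatFunc K) g ∈ regular K :=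
  ⟨g, 1, by simp, by rw [map_one, mul_one]⟩

theorem X_mem : (RatFunc.X : RatFunc K) ∈ regular K := by
  rw [← RatFunc.algebraMap_X]; exact algebraMap_mem _

theorem algebraMap_inv_mem {h : K[X]} (h0 : h.eval 0 = 1) :
    (algebraMap K[X] (RatFunc K) h)⁻¹ ∈ regular K := by
  refine ⟨1, h, h0, ?_⟩
  rw [map_one, inv_mul_cancel₀]
  refine RatFunc.algebraMap_ne_zero ?_
  rintro rfl
  simp at h0

theorem exists_eq_add {a : RatFunc K} (ha : a ∈ regular K) :
    ∃ (c : K), ∃ b ∈ regular K, a = algebraMap K _ c + RatFunc.X * b := by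
  obtain ⟨g, h, h0, h1⟩ := ha
  have hh : algebraMap K[X] (RatFunc K) h ≠ 0 := by
    refine RatFunc.algebraMap_ne_zero ?_
    rintro rfl
    simp at h0
  have hd : (Polynomial.X : K[X]) ∣ g - Polynomial.C (g.eval 0) * h := by
    rw [X_dvd_iff, coeff_zero_eq_eval_zero]; simp [h0]
  obtain ⟨k, hk⟩ := hd
  refine ⟨g.eval 0, algebraMap K[X] (RatFunc K) k * (algebraMap K[X] (RatFunc K) h)⁻¹,
    mul_mem (algebraMap_mem _) (algebraMap_inv_mem h0), ?_⟩
  have h2 := congrArg (algebraMap K[X] (RatFunc K)) hk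
  rw [map_sub, map_mul, map_mul, ← h1, RatFunc.algebraMap_X, RatFunc.algebraMap_C] at h2
  have h3 : algebraMap K (RatFunc K) (g.eval 0) = RatFunc.C (g.eval 0) := rfl
  rw [h3]
  field_simp
  linear_combination h2

variable (K) in
/-- The span of the powers `x⁻ⁿ`, `n ≥ 1`. -/
def polar : Submodule K (RatFunc K) :=
  Submodule.span K (Set.range fun n : ℕ => (RatFunc.X : RatFunc K)⁻¹ ^ (n + 1))

theorem X_inv_mul_mem {f : RatFunc K} (hf : f ∈ polar K) : RatFunc.X⁻¹ * f ∈ polar K := by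
  induction hf using Submodule.span_induction with
  | mem f hf =>
    obtain ⟨n, rfl⟩ := hf
    exact Submodule.subset_span ⟨n + 1, by simp only; ring⟩
  | zero => rw [mul_zero]; exact zero_mem _
  | add a b _ _ ha hb => rw [mul_add]; exact add_mem ha hb
  | smul c a _ ha => rw [mul_smul_comm]; exact Submodule.smul_mem _ _ ha

theorem X_inv_mem : (RatFunc.X : RatFunc K)⁻¹ ∈ polar K :=
  Submodule.subset_span ⟨0, by simp⟩

theorem exists_mul_X_pow_eq {f : RatFunc K} (hf : f ∈ polar K) :
    ∃ (N : ℕ) (p : K[X]), p.degree < N ∧ f * RatFunc.X ^ N = algebraMap K[X] (RatFunc K) p := by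
  have hX : (RatFunc.X : RatFunc K) ≠ 0 := RatFunc.X_ne_zero
  induction hf using Submodule.span_induction with
  | mem f hf =>
    obtain ⟨n, rfl⟩ := hf
    exact ⟨n + 1, 1, by simpa using Nat.cast_add_one_pos (α := WithBot ℕ) n, by
      rw [← mul_pow, inv_mul_cancel₀ hX, one_pow, map_one]⟩
  | zero => exact ⟨0, 0, by simp, by simp⟩
  | add a b _ _ ha hb =>
    obtain ⟨N, p, hp, h⟩ := ha
    obtain ⟨N', p', hp', h'⟩ := hb
    refine ⟨N + N', p * X ^ N' + p' * X ^ N, ?_, ?_⟩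
    · refine (degree_add_le _ _).trans_lt (max_lt ?_ ?_)
      · rw [degree_mul, degree_X_pow, Nat.cast_add]
        exact WithBot.add_lt_add_right (by simp) hp
      · rw [degree_mul, degree_X_pow, Nat.cast_add, add_comm]
        exact WithBot.add_lt_add_left (by simp) hp'
    · rw [map_add, map_mul, map_mul, ← h, ← h', map_pow, map_pow, RatFunc.algebraMap_X]
      ring
  | smul c a _ ha =>
    obtain ⟨N, p, hp, h⟩ := ha
    refine ⟨N, c • p, (degree_smul_le _ _).trans_lt hp, ?_⟩
    rw [smul_mul_assoc, h, smul_eq_C_mul, map_mul, RatFunc.algebraMap_C, RatFunc.smul_eq_C_mul]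

variable (K) in
theorem isCompl : IsCompl (polar K) (Subalgebra.toSubmodule (regular K)) := by
  constructor
  · rw [Submodule.disjoint_def]
    rintro f hf ⟨g, h, h0, h1⟩
    obtain ⟨N, p, hp, h2⟩ := exists_mul_X_pow_eq hf
    -- A common element gives ph = x^N g with h prime to x. Thus x^N divides p, and the degree bound
    -- forces p = 0.
    have h3 : p * h = X ^ N * g := by
      apply RatFunc.algebraMap_injective K
      rw [map_mul, map_mul, ← h1, ← h2, map_pow, RatFunc.algebraMap_X]
      ring
    have h4 : IsCoprime (X ^ N : K[X]) h := by
      apply IsCoprime.pow_left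
      rw [(prime_X (R := K)).irreducible.coprime_iff_not_dvd, X_dvd_iff,
        coeff_zero_eq_eval_zero, h0]
      exact one_ne_zero
    have h5 : p = 0 := eq_zero_of_dvd_of_degree_lt (h4.dvd_of_dvd_mul_right ⟨g, h3⟩)
      (by rwa [degree_X_pow])
    rw [h5, map_zero] at h2
    exact (mul_eq_zero.1 h2).resolve_right (pow_ne_zero _ RatFunc.X_ne_zero)
  · rw [codisjoint_iff, eq_top_iff]
    -- The sum contains the regular part and is stable under x⁻¹, and every rational function is a
    -- power of x⁻¹ times a regular one.
    set S := polar K ⊔ Subalgebra.toSubmodule (regular K) with hS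
    have hA : ∀ a ∈ regular K, a ∈ S := fun a ha => Submodule.mem_sup_right ha
    have hX : ∀ f ∈ S, RatFunc.X⁻¹ * f ∈ S := by
      intro f hf
      obtain ⟨c, hc, a, ha, rfl⟩ := Submodule.mem_sup.1 hf
      obtain ⟨k, b, hb, rfl⟩ := exists_eq_add ha
      rw [mul_add, mul_add, ← mul_assoc _ _ b, inv_mul_cancel₀ RatFunc.X_ne_zero, one_mul,
        mul_comm _ (algebraMap _ _ k), ← Algebra.smul_def]
      exact add_mem (Submodule.mem_sup_left (X_inv_mul_mem hc))
        (add_mem (Submodule.smul_mem _ _ (Submodule.mem_sup_left X_inv_mem)) (hA _ hb))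
    have hXn : ∀ n : ℕ, ∀ f ∈ S, (RatFunc.X : RatFunc K)⁻¹ ^ n * f ∈ S := by
      intro n
      induction n with
      | zero => intro f hf; simpa using hf
      | succ n ih => intro f hf; rw [pow_succ, mul_assoc]; exact ih _ (hX _ hf)
    rintro f -
    induction f using RatFunc.induction_on with
    | f g h hh =>
      obtain ⟨h', hh', h0⟩ := Polynomial.exists_eq_pow_rootMultiplicity_mul_and_not_dvd h hh 0
      rw [C_0, sub_zero] at hh' h0
      have hc : h'.eval 0 ≠ 0 := by
        rwa [X_dvd_iff, coeff_zero_eq_eval_zero] at h0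
      have h1 : (algebraMap K[X] (RatFunc K) (C (h'.eval 0)⁻¹ * h'))⁻¹ ∈ regular K :=
        algebraMap_inv_mem (by simp [hc])
      have h2 : algebraMap K[X] (RatFunc K) g / algebraMap K[X] (RatFunc K) h =
          RatFunc.X⁻¹ ^ (rootMultiplicity 0 h) * (algebraMap K[X] (RatFunc K) (g * C (h'.eval 0)⁻¹) *
            (algebraMap K[X] (RatFunc K) (C (h'.eval 0)⁻¹ * h'))⁻¹) := by
        have e1 : algebraMap K[X] (RatFunc K) (C (h'.eval 0)⁻¹) ≠ 0 :=
          RatFunc.algebraMap_ne_zero (by simpa using hc)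
        have e2 : algebraMap K[X] (RatFunc K) h' ≠ 0 :=
          RatFunc.algebraMap_ne_zero (by rintro rfl; simp at hc)
        have e3 : (RatFunc.X : RatFunc K) ≠ 0 := RatFunc.X_ne_zero
        conv_lhs => rw [hh']
        rw [map_mul, map_mul, map_mul, map_pow, RatFunc.algebraMap_X, inv_pow]
        generalize algebraMap K[X] (RatFunc K) (C (h'.eval 0)⁻¹) = c at e1 ⊢
        field_simp
      rw [h2]
      exact hXn _ _ (hA _ (mul_mem (algebraMap_mem _) h1))

end RatFuncSplit

end

/-! ### Compressed multiplications and the representation of `Q` -/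

noncomputable section

namespace RatFuncSplit

open Polynomial

variable {K : Type u} [Field K]

variable (K) in
/-- The submodule of rational functions that are regular at `0`. -/
abbrev reg : Submodule K (RatFunc K) := Subalgebra.toSubmodule (regular K)

variable (K) in
/-- The projection onto the polar part. -/
abbrev projC : RatFunc K →ₗ[K] polar K := (polar K).projectionOnto (reg K) (isCompl K)

variable (K) in
/-- The projection onto the regular part. -/
abbrev projA : RatFunc K →ₗ[K] reg K := (reg K).projectionOnto (polar K) (isCompl K).symm

/-- Multiplication by a rational function. -/
abbrev mulF (f : RatFunc K) : Module.End K (RatFunc K) := Algebra.lmul K (RatFunc K) f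

theorem incl_add_incl (f : RatFunc K) : (projC K f : RatFunc K) + (projA K f : RatFunc K) = f := by
  have h := (isCompl K).sup_eq_top
  obtain ⟨c, hc, a, ha, rfl⟩ := Submodule.mem_sup.1 (h ▸ Submodule.mem_top : f ∈ polar K ⊔ reg K)
  rw [map_add, map_add, Submodule.projectionOnto_apply_of_mem_left _ hc,
    Submodule.projectionOnto_apply_of_mem_right _ ha, Submodule.projectionOnto_apply_of_mem_left _ ha,
    Submodule.projectionOnto_apply_of_mem_right _ hc]
  simp

/-- The compression of a multiplication to the polar part. -/
def compC (f : RatFunc K) : Module.End K (polar K) := projC K ∘ₗ mulF f ∘ₗ (polar K).subtype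

/-- The compression of a multiplication to the regular part. -/
def compA (f : RatFunc K) : Module.End K (reg K) := projA K ∘ₗ mulF f ∘ₗ (reg K).subtype

/-- The part of a multiplication that sends the regular part to the polar part. -/
def hankC (f : RatFunc K) : reg K →ₗ[K] polar K := projC K ∘ₗ mulF f ∘ₗ (reg K).subtype

/-- The part of a multiplication that sends the polar part to the regular part. -/
def hankA (f : RatFunc K) : polar K →ₗ[K] reg K := projA K ∘ₗ mulF f ∘ₗ (polar K).subtype

/-- The identity is inserted between the factors as the sum of the two projections; the Hankel term
is the defect of multiplicativity. -/
theorem compC_mul (f g : RatFunc K) :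
    compC (f * g) = compC f * compC g + hankC f ∘ₗ hankA g := by
  ext1 c
  change projC K (f * g * (c : RatFunc K)) =
    projC K (f * (projC K (g * (c : RatFunc K)) : RatFunc K)) +
      projC K (f * (projA K (g * (c : RatFunc K)) : RatFunc K))
  conv_lhs => rw [mul_assoc, ← incl_add_incl (g * (c : RatFunc K)), mul_add, map_add]

theorem compA_mul (f g : RatFunc K) :
    compA (f * g) = compA f * compA g + hankA f ∘ₗ hankC g := by
  ext1 c
  change projA K (f * g * (c : RatFunc K)) =
    projA K (f * (projA K (g * (c : RatFunc K)) : RatFunc K)) +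
      projA K (f * (projC K (g * (c : RatFunc K)) : RatFunc K))
  conv_lhs => rw [mul_assoc, ← incl_add_incl (g * (c : RatFunc K)), mul_add, map_add, add_comm]

theorem hankC_eq_zero {f : RatFunc K} (hf : f ∈ regular K) : hankC f = 0 := by
  ext1 a
  have h : f * (a : RatFunc K) ∈ regular K := mul_mem hf a.2
  change projC K (f * (a : RatFunc K)) = 0
  exact Submodule.projectionOnto_apply_of_mem_right (isCompl K) h

theorem hankA_X_inv : hankA (RatFunc.X⁻¹ : RatFunc K) = 0 := by
  ext1 c
  change projA K (RatFunc.X⁻¹ * (c : RatFunc K)) = 0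
  exact Submodule.projectionOnto_apply_of_mem_right (isCompl K).symm (X_inv_mul_mem c.2)

theorem compC_algebraMap (c : K) : compC (algebraMap K (RatFunc K) c) = algebraMap K _ c := by
  ext1 a
  change projC K (algebraMap K _ c * a) = c • a
  rw [← Algebra.smul_def, map_smul, Submodule.projectionOnto_apply_left]

theorem compA_algebraMap (c : K) : compA (algebraMap K (RatFunc K) c) = algebraMap K _ c := by
  ext1 a
  change projA K (algebraMap K _ c * a) = c • a
  rw [← Algebra.smul_def, map_smul, Submodule.projectionOnto_apply_left]

theorem compC_add (f g : RatFunc K) : compC (f + g) = compC f + compC g := by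
  rw [compC, mulF, map_add, LinearMap.add_comp, LinearMap.comp_add]; rfl

theorem compA_add (f g : RatFunc K) : compA (f + g) = compA f + compA g := by
  rw [compA, mulF, map_add, LinearMap.add_comp, LinearMap.comp_add]; rfl

variable (K) in
/-- The action of the local ring on the polar part. -/
def polarHom : regular K →ₐ[K] Module.End K (polar K) where
  toFun a := compC (a : RatFunc K)
  map_one' := by simpa using compC_algebraMap (1 : K)
  map_mul' a b := by
    rw [MulMemClass.coe_mul, compC_mul, hankC_eq_zero a.2, LinearMap.zero_comp, add_zero]
  map_zero' := by simpa using compC_algebraMap (0 : K)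
  map_add' a b := compC_add _ _
  commutes' c := compC_algebraMap c

variable (K) in
/-- The right action of the local ring on itself. -/
def regHom : regular K →ₐ[K] (Module.End K (reg K))ᵐᵒᵖ where
  toFun a := .op (compA (a : RatFunc K))
  map_one' := congrArg MulOpposite.op (by simpa using compA_algebraMap (1 : K))
  map_mul' a b := by
    rw [← MulOpposite.op_mul, MulMemClass.coe_mul, mul_comm, compA_mul, hankC_eq_zero a.2,
      LinearMap.comp_zero, add_zero]
  map_zero' := congrArg MulOpposite.op (by simpa using compA_algebraMap (0 : K))
  map_add' a b := congrArg MulOpposite.op (compA_add _ _)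
  commutes' c := congrArg MulOpposite.op (compA_algebraMap c)

variable (K) in
/-- The element `x` of the local ring. -/
def regX : regular K := ⟨RatFunc.X, X_mem⟩

theorem coe_aeval_regX (f : K[X]) :
    ((aeval (regX K) f : regular K) : RatFunc K) = algebraMap K[X] (RatFunc K) f := by
  have h := Polynomial.aeval_algHom_apply (regular K).val (regX K) f
  refine h.symm.trans ?_
  change aeval (RatFunc.X : RatFunc K) f = _
  rw [← RatFunc.algebraMap_X, Polynomial.aeval_algebraMap_apply, aeval_X_left_apply]

theorem isUnit_aeval_regX {f : K[X]} (hf : f.eval 0 = 1) : IsUnit (aeval (regX K) f) := by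
  refine IsUnit.of_mul_eq_one (⟨_, algebraMap_inv_mem hf⟩ : regular K) (Subtype.ext ?_)
  rw [MulMemClass.coe_mul, coe_aeval_regX]
  refine mul_inv_cancel₀ (RatFunc.algebraMap_ne_zero ?_)
  rintro rfl
  simp at hf

section lift

variable {B : Type w} [Ring B] [Algebra K B]

/-- The homomorphism from `Q₁` given by an action of the local ring and a right inverse of `x`. -/
def liftReg (φ : regular K →ₐ[K] B) (b : B) (h : φ (regX K) * b = 1) : Q1 K →ₐ[K] B :=
  UnivLoc.lift (Q0.lift (φ (regX K)) b h) fun s hs => by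
    obtain ⟨f, hf, rfl⟩ := hs
    rw [← Polynomial.aeval_algHom_apply, Q0.lift_x, Polynomial.aeval_algHom_apply]
    exact (isUnit_aeval_regX hf).map φ

theorem liftReg_x (φ : regular K →ₐ[K] B) (b : B) (h : φ (regX K) * b = 1) :
    liftReg φ b h (Q1.x K) = φ (regX K) := by
  rw [liftReg, Q1.x, UnivLoc.lift_of, Q0.lift_x]

theorem liftReg_y (φ : regular K →ₐ[K] B) (b : B) (h : φ (regX K) * b = 1) :
    liftReg φ b h (Q1.y K) = b := by
  rw [liftReg, Q1.y, UnivLoc.lift_of, Q0.lift_y]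

theorem liftReg_isLoc (φ : regular K →ₐ[K] B) (b : B) (h : φ (regX K) * b = 1) {a : Q1 K}
    (ha : Q1.IsLoc a) : ∃ ha' : Q1.toRatFunc K a ∈ regular K,
      liftReg φ b h a = φ ⟨Q1.toRatFunc K a, ha'⟩ := by
  obtain ⟨g, d, d0, hd⟩ := ha
  have h1 := congrArg (Q1.toRatFunc K) hd
  rw [map_mul, Q1.toRatFunc_aeval, Q1.toRatFunc_aeval] at h1
  refine ⟨⟨g, d, d0, h1⟩, ?_⟩
  have h2 := congrArg (liftReg φ b h) hd
  rw [map_mul, ← Polynomial.aeval_algHom_apply, ← Polynomial.aeval_algHom_apply, liftReg_x,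
    Polynomial.aeval_algHom_apply, Polynomial.aeval_algHom_apply] at h2
  refine ((isUnit_aeval_regX (K := K) d0).map φ).mul_left_injective ?_
  change _ * φ _ = φ _ * φ _
  rw [h2, ← map_mul]
  congr 1
  apply Subtype.ext
  rw [MulMemClass.coe_mul, coe_aeval_regX, coe_aeval_regX, h1]

end lift

variable (K) in
/-- The representation of `Q₁` on the polar part. -/
def polarRep : Q1 K →ₐ[K] Module.End K (polar K) :=
  liftReg (polarHom K) (compC RatFunc.X⁻¹) (by
    change compC RatFunc.X * compC RatFunc.X⁻¹ = 1
    have h := compC_mul (K := K) RatFunc.X RatFunc.X⁻¹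
    rw [hankA_X_inv, LinearMap.comp_zero, add_zero, mul_inv_cancel₀ RatFunc.X_ne_zero] at h
    rw [← h]
    simpa using compC_algebraMap (1 : K))

variable (K) in
/-- The right representation of `Q₁` on the regular part. -/
def regRep : Q1 K →ₐ[K] (Module.End K (reg K))ᵐᵒᵖ :=
  liftReg (regHom K) (.op (compA RatFunc.X⁻¹)) (by
    change MulOpposite.op (compA RatFunc.X) * MulOpposite.op (compA RatFunc.X⁻¹) = 1
    -- On the regular part, the compression of x⁻¹ is a left inverse of multiplication by x. In the
    -- opposite ring it becomes the right inverse that y requires.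
    have h := compA_mul (K := K) RatFunc.X⁻¹ RatFunc.X
    rw [hankC_eq_zero X_mem, LinearMap.comp_zero, add_zero, inv_mul_cancel₀ RatFunc.X_ne_zero] at h
    rw [← MulOpposite.op_mul, ← h, ← MulOpposite.op_one]
    exact congrArg MulOpposite.op (by simpa using compA_algebraMap (1 : K)))

/-- For a regular function with value c at 0, the polar part of its product with x⁻¹ is cx⁻¹. -/
theorem isFinRank_hankC_X_inv : IsFinRank (hankC (RatFunc.X⁻¹ : RatFunc K)) := by
  have : FiniteDimensional K (Submodule.span K {(⟨RatFunc.X⁻¹, X_inv_mem⟩ : polar K)}) :=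
    inferInstance
  refine IsFinRank.of_range_le (Submodule.span K {(⟨RatFunc.X⁻¹, X_inv_mem⟩ : polar K)}) ?_
  rintro _ ⟨⟨a, ha⟩, rfl⟩
  obtain ⟨c, b, hb, rfl⟩ := exists_eq_add ha
  change projC K (RatFunc.X⁻¹ * (algebraMap K _ c + RatFunc.X * b)) ∈ _
  rw [mul_add, ← mul_assoc, inv_mul_cancel₀ RatFunc.X_ne_zero, one_mul, map_add,
    Submodule.projectionOnto_apply_of_mem_right (isCompl K) (x := b) hb, add_zero, mul_comm,
    ← Algebra.smul_def, map_smul, Submodule.projectionOnto_apply_of_mem_left _ X_inv_mem]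
  exact Submodule.smul_mem _ _ (Submodule.mem_span_singleton_self _)

/-- Elements g(x)h(x)⁻¹ act exactly as compressions, and each factor y contributes only a composite
with the finite-rank Hankel map of x⁻¹. -/
theorem isFinRank_polarRep_sub (a : Q1 K) :
    IsFinRank (polarRep K a - compC (Q1.toRatFunc K a)) := by
  induction a using Q1.isLoc_induction with
  | loc a ha =>
    obtain ⟨ha', h⟩ := liftReg_isLoc (polarHom K) (compC RatFunc.X⁻¹) _ ha
    have h1 : polarRep K a = compC (Q1.toRatFunc K a) := h
    rw [h1, sub_self]
    exact IsFinRank.zero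
  | add a b ha hb =>
    rw [map_add, map_add, compC_add, add_sub_add_comm]
    exact ha.add hb
  | y_mul a ha =>
    have h : polarRep K (Q1.y K) = compC RatFunc.X⁻¹ := liftReg_y _ _ _
    rw [map_mul, map_mul, Q1.toRatFunc_y, compC_mul, h, ← sub_sub, ← mul_sub]
    exact (ha.comp_left _).sub (isFinRank_hankC_X_inv.comp_right _)

theorem isFinRank_regRep_sub (a : Q1 K) :
    IsFinRank ((regRep K a).unop - compA (Q1.toRatFunc K a)) := by
  induction a using Q1.isLoc_induction with
  | loc a ha =>
    obtain ⟨ha', h⟩ := liftReg_isLoc (regHom K) (.op (compA RatFunc.X⁻¹)) _ ha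
    have h1 : (regRep K a).unop = compA (Q1.toRatFunc K a) := congrArg MulOpposite.unop h
    rw [h1, sub_self]
    exact IsFinRank.zero
  | add a b ha hb =>
    rw [map_add, map_add, compA_add, MulOpposite.unop_add, add_sub_add_comm]
    exact ha.add hb
  | y_mul a ha =>
    have h : regRep K (Q1.y K) = .op (compA RatFunc.X⁻¹) := liftReg_y _ _ _
    rw [map_mul, map_mul, Q1.toRatFunc_y, mul_comm RatFunc.X⁻¹, compA_mul, h,
      MulOpposite.unop_mul, MulOpposite.unop_op, ← sub_sub, ← sub_mul]
    exact (ha.comp_right _).sub (isFinRank_hankC_X_inv.comp_left _)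

variable (K) in
/-- The projection onto the polar part, as an endomorphism. -/
def P : Module.End K (RatFunc K) := (polar K).subtype ∘ₗ projC K

theorem subtype_comp_projA : (reg K).subtype ∘ₗ projA K = 1 - P K := by
  ext1 f
  change (projA K f : RatFunc K) = f - (projC K f : RatFunc K)
  rw [eq_sub_iff_add_eq, add_comm, incl_add_incl]

theorem P_mul_P : P K * P K = P K := by
  ext1 f
  change ((projC K (projC K f : RatFunc K) : polar K) : RatFunc K) = (projC K f : RatFunc K)
  rw [Submodule.projectionOnto_apply_left]

/-- The f that commute with P up to finite rank form a subfield containing K, and x⁻¹ belongs to it.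
-/
theorem isFinRank_commutator (f : RatFunc K) : IsFinRank (P K * mulF f - mulF f * P K) := by
  have hmul : ∀ f g : RatFunc K, IsFinRank (P K * mulF f - mulF f * P K) →
      IsFinRank (P K * mulF g - mulF g * P K) →
      IsFinRank (P K * mulF (f * g) - mulF (f * g) * P K) := by
    intro f g hf hg
    have h : P K * mulF (f * g) - mulF (f * g) * P K =
        (P K * mulF f - mulF f * P K) * mulF g + mulF f * (P K * mulF g - mulF g * P K) := by
      simp only [mulF, map_mul]
      noncomm_ring
    rw [h]
    exact (hf.comp_right _).add (hg.comp_left _)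
  have hinv : ∀ f : RatFunc K, IsFinRank (P K * mulF f - mulF f * P K) →
      IsFinRank (P K * mulF f⁻¹ - mulF f⁻¹ * P K) := by
    intro f hf
    by_cases hf0 : f = 0
    · rwa [hf0, inv_zero, ← hf0]
    have h1 : mulF f * mulF f⁻¹ = 1 := by
      rw [mulF, mulF, ← map_mul, mul_inv_cancel₀ hf0, map_one]
    have h2 : mulF f⁻¹ * mulF f = 1 := by
      rw [mulF, mulF, ← map_mul, inv_mul_cancel₀ hf0, map_one]
    have h : P K * mulF f⁻¹ - mulF f⁻¹ * P K =
        -(mulF f⁻¹ * ((P K * mulF f - mulF f * P K) * mulF f⁻¹)) := by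
      rw [sub_mul, mul_assoc (P K), h1, mul_one, mul_sub, ← mul_assoc, ← mul_assoc, h2, one_mul,
        neg_sub]
    rw [h]
    exact ((hf.comp_right _).comp_left _).neg
  have hscal : ∀ c : K, IsFinRank (P K * mulF (algebraMap K _ c) - mulF (algebraMap K _ c) * P K) :=
    fun c => by
      rw [mulF, AlgHom.commutes, Algebra.commutes, sub_self]
      exact IsFinRank.zero
  have hXinv : IsFinRank (P K * mulF (RatFunc.X⁻¹) - mulF (RatFunc.X⁻¹) * P K) := by
    have h : P K * mulF (RatFunc.X⁻¹) - mulF (RatFunc.X⁻¹) * P K =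
        (polar K).subtype ∘ₗ hankC RatFunc.X⁻¹ ∘ₗ projA K := by
      ext1 f
      change ((projC K (RatFunc.X⁻¹ * f) : polar K) : RatFunc K) - RatFunc.X⁻¹ * (projC K f : RatFunc K) =
        ((projC K (RatFunc.X⁻¹ * (projA K f : RatFunc K)) : polar K) : RatFunc K)
      conv_lhs => rw [← incl_add_incl f, mul_add, map_add]
      rw [incl_add_incl, Submodule.projectionOnto_apply_of_mem_left _
        (X_inv_mul_mem (projC K f).2), Submodule.coe_add, add_sub_cancel_left]
    rw [h]
    exact (isFinRank_hankC_X_inv.comp_right _).comp_left _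
  have hX : IsFinRank (P K * mulF (RatFunc.X) - mulF (RatFunc.X) * P K) := by
    simpa using hinv _ hXinv
  have hadd : ∀ f g : RatFunc K, IsFinRank (P K * mulF f - mulF f * P K) →
      IsFinRank (P K * mulF g - mulF g * P K) →
      IsFinRank (P K * mulF (f + g) - mulF (f + g) * P K) := by
    intro f g hf hg
    rw [mulF, map_add, mul_add, add_mul, add_sub_add_comm]
    exact hf.add hg
  have hpoly : ∀ p : K[X], IsFinRank (P K * mulF (algebraMap K[X] (RatFunc K) p) -
      mulF (algebraMap K[X] (RatFunc K) p) * P K) := by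
    intro p
    induction p using Polynomial.induction_on with
    | C c => rw [RatFunc.algebraMap_C]; exact hscal c
    | add p q hp hq => rw [map_add]; exact hadd _ _ hp hq
    | monomial n c h =>
      rw [pow_succ, ← mul_assoc, map_mul, RatFunc.algebraMap_X]
      exact hmul _ _ h hX
  induction f using RatFunc.induction_on with
  | f g h hh => rw [div_eq_mul_inv]; exact hmul _ _ (hpoly g) (hinv _ (hpoly h))

end RatFuncSplit

namespace Q

open RatFuncSplit

variable (K : Type u) [Field K]

theorem projC_incl (c : polar K) : projC K (c : RatFunc K) = c :=
  Submodule.projectionOnto_apply_left _ c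

theorem projA_incl (a : reg K) : projA K (a : RatFunc K) = a :=
  Submodule.projectionOnto_apply_left _ a

theorem projC_incl_reg (a : reg K) : projC K (a : RatFunc K) = 0 :=
  Submodule.projectionOnto_apply_right _ a

theorem projA_incl_polar (c : polar K) : projA K (c : RatFunc K) = 0 :=
  Submodule.projectionOnto_apply_right _ c

/-- The representation of `Q` on `K(x)`, the sum of its polar and its regular part. -/
def rep : Q K →+* Module.End K (RatFunc K) where
  toFun a := (polar K).subtype ∘ₗ polarRep K a.1.1 ∘ₗ projC K +
    (reg K).subtype ∘ₗ (regRep K a.1.2.unop).unop ∘ₗ projA K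
  map_one' := by
    ext1 f
    rw [fst_one, snd_one, map_one, map_one]
    exact incl_add_incl f
  map_zero' := by
    rw [fst_zero, snd_zero, map_zero, map_zero]
    simp
  map_add' a b := by
    rw [fst_add, snd_add, map_add, map_add, MulOpposite.unop_add]
    simp only [LinearMap.comp_add, LinearMap.add_comp]
    abel
  map_mul' a b := by
    rw [fst_mul, snd_mul, map_mul, map_mul, MulOpposite.unop_mul]
    ext1 f
    simp only [LinearMap.add_apply, LinearMap.comp_apply, Module.End.mul_apply,
      Submodule.subtype_apply, map_add, projC_incl, projA_incl, projC_incl_reg, projA_incl_polar,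
      map_zero, add_zero, zero_add]

/-- Both coordinates have the same image f in K(x), so the two actions are compressions of one
multiplication, up to finite rank. -/
theorem isFinRank_rep_sub (a : Q K) : IsFinRank (rep K a - mulF (toRatFunc K a)) := by
  set f := toRatFunc K a with hf
  have h1 : Q1.toRatFunc K a.1.1 = f := rfl
  have h2 : Q1.toRatFunc K a.1.2.unop = f := toRatFunc_snd a
  have k1 := isFinRank_polarRep_sub a.1.1
  have k2 := isFinRank_regRep_sub a.1.2.unop
  rw [h1] at k1
  rw [h2] at k2
  have k3 := isFinRank_commutator f
  have h3 : (polar K).subtype ∘ₗ compC f ∘ₗ projC K = P K * mulF f * P K := rfl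
  have h4 : (reg K).subtype ∘ₗ compA f ∘ₗ projA K = (1 - P K) * mulF f * (1 - P K) := by
    rw [← subtype_comp_projA]; rfl
  have h5 : rep K a - mulF f =
      (polar K).subtype ∘ₗ (polarRep K a.1.1 - compC f) ∘ₗ projC K +
      (reg K).subtype ∘ₗ ((regRep K a.1.2.unop).unop - compA f) ∘ₗ projA K +
      (P K * mulF f - mulF f * P K) * (P K + P K - 1) := by
    -- The two diagonal blocks of f differ from f by [P, f](2P - 1), which has finite rank by
    -- `isFinRank_commutator`.
    have h6 : (P K * mulF f - mulF f * P K) * (P K + P K - 1) =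
        P K * mulF f * P K + (1 - P K) * mulF f * (1 - P K) - mulF f := by
      have h7 : mulF f * P K * P K = mulF f * P K := by rw [mul_assoc, P_mul_P]
      simp only [sub_mul, mul_sub, mul_add, one_mul, mul_one, h7]
      abel
    rw [h6, ← h3, ← h4]
    have h8 : rep K a = (polar K).subtype ∘ₗ polarRep K a.1.1 ∘ₗ projC K +
      (reg K).subtype ∘ₗ (regRep K a.1.2.unop).unop ∘ₗ projA K := rfl
    rw [h8]
    simp only [LinearMap.comp_sub, LinearMap.sub_comp]
    abel
  rw [h5]
  exact (((k1.comp_right _).comp_left _).add ((k2.comp_right _).comp_left _)).add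
    (k3.comp_right _)

/-- The constant function 1 is fixed by e₁: the function x⁻¹ is polar, so the compression of x⁻¹ to
the regular part kills 1. -/
theorem rep_e₁_ne_zero : rep K (e₁ K) ≠ 0 := by
  intro h
  have h1 := congrArg (fun T : Module.End K (RatFunc K) => T 1) h
  have h2 : rep K (e₁ K) 1 = 1 := by
    have hA : projA K 1 = ⟨1, one_mem (regular K)⟩ :=
      Submodule.projectionOnto_apply_of_mem_left _ (one_mem (regular K))
    have hC : projC K 1 = 0 :=
      Submodule.projectionOnto_apply_of_mem_right _ (one_mem (regular K))
    have hx : regRep K (Q1.x K) = .op (compA RatFunc.X) := liftReg_x _ _ _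
    have hy : regRep K (Q1.y K) = .op (compA RatFunc.X⁻¹) := liftReg_y _ _ _
    have hT : (regRep K (Q1.e K)).unop = 1 - compA RatFunc.X * compA RatFunc.X⁻¹ := by
      rw [Q1.e, map_sub, map_one, map_mul, hx, hy]
      rfl
    have h0 : compA RatFunc.X⁻¹ (⟨1, one_mem (regular K)⟩ : reg K) = 0 := by
      change projA K (RatFunc.X⁻¹ * 1) = 0
      rw [mul_one]
      exact Submodule.projectionOnto_apply_of_mem_right _ X_inv_mem
    change ((polarRep K 0 (projC K 1) : polar K) : RatFunc K) +
      ((regRep K (Q1.e K)).unop (projA K 1) : reg K) = 1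
    rw [hT, hA, hC, map_zero, LinearMap.sub_apply, Module.End.mul_apply, h0, map_zero, sub_zero]
    simp
  simp only [h2, LinearMap.zero_apply] at h1
  exact one_ne_zero h1

end Q

end

/-! ### The index argument -/

noncomputable section

theorem finrank_le_of_injective_of_isFinRank {K : Type*} [Field K] {X N N' : Type*}
    [AddCommGroup X] [Module K X] [AddCommGroup N] [Module K N] [AddCommGroup N'] [Module K N']
    [FiniteDimensional K N] [FiniteDimensional K N'] (G : X × N' →ₗ[K] X × N)
    (hG : Function.Injective G) (h : X ≃ₗ[K] X)
    (hh : IsFinRank (LinearMap.fst K X N ∘ₗ G ∘ₗ LinearMap.inl K X N' - h.toLinearMap)) :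
    Module.finrank K N' ≤ Module.finrank K N := by
  set D := LinearMap.fst K X N ∘ₗ G ∘ₗ LinearMap.inl K X N' - h.toLinearMap with hD
  set B := LinearMap.fst K X N ∘ₗ G ∘ₗ LinearMap.inr K X N' with hB
  have : FiniteDimensional K (LinearMap.range D) := hh
  -- S is finite-dimensional and contains the X-component of G outside that of h. So G maps h⁻¹(S) ×
  -- N' into S × N, and h⁻¹(S) and S have equal dimension.
  set S := LinearMap.range D ⊔ LinearMap.range B with hS
  set S' := S.comap h.toLinearMap with hS'
  have e : S' ≃ₗ[K] S := h.ofSubmodule' S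
  have : FiniteDimensional K S' := e.symm.finiteDimensional
  have hmem : ∀ s : S', ∀ n : N', (G ((s : X), n)).1 ∈ S := by
    intro s n
    have h1 : (G ((s : X), n)).1 = D s + h s + B n := by
      have : (((s : X), n) : X × N') = ((s : X), 0) + (0, n) := by simp
      rw [this, map_add]
      simp [D, B]
    rw [h1]
    exact add_mem (add_mem (Submodule.mem_sup_left ⟨_, rfl⟩) s.2) (Submodule.mem_sup_right ⟨_, rfl⟩)
  let G' : S' × N' →ₗ[K] S × N :=
    LinearMap.prod
      (LinearMap.codRestrict S (LinearMap.fst K X N ∘ₗ G ∘ₗ S'.subtype.prodMap LinearMap.id)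
        fun s => hmem s.1 s.2)
      (LinearMap.snd K X N ∘ₗ G ∘ₗ S'.subtype.prodMap LinearMap.id)
  have hG' : Function.Injective G' := by
    rintro ⟨s, n⟩ ⟨t, m⟩ hst
    have h1 : G ((s : X), n) = G ((t : X), m) :=
      Prod.ext (congrArg (fun z : S × N => (z.1 : X)) hst) (congrArg (fun z : S × N => z.2) hst)
    have h2 := hG h1
    rw [Prod.mk.injEq] at h2 ⊢
    exact ⟨Subtype.ext h2.1, h2.2⟩
  have h3 := LinearMap.finrank_le_finrank_of_injective hG'
  rw [Module.finrank_prod, Module.finrank_prod, e.finrank_eq] at h3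
  exact Nat.le_of_add_le_add_left h3

section MatAct

variable {K : Type*} [Field K] {V : Type*} [AddCommGroup V] [Module K V]

/-- The action of a matrix of endomorphisms on column vectors. -/
def matAct {m n : Type} [Fintype n] (M : Matrix m n (Module.End K V)) : (n → V) →ₗ[K] (m → V) :=
  LinearMap.pi fun i => ∑ j, M i j ∘ₗ LinearMap.proj j

theorem matAct_apply {m n : Type} [Fintype n] (M : Matrix m n (Module.End K V)) (v : n → V)
    (i : m) : matAct M v i = ∑ j, M i j (v j) := by
  simp [matAct]

theorem matAct_mul {l m n : Type} [Fintype m] [Fintype n] (M : Matrix l m (Module.End K V))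
    (N : Matrix m n (Module.End K V)) (v : n → V) :
    matAct (M * N) v = matAct M (matAct N v) := by
  ext i
  simp only [matAct_apply, Matrix.mul_apply, LinearMap.sum_apply, map_sum, Module.End.mul_apply]
  exact Finset.sum_comm

theorem matAct_one {n : Type} [Fintype n] [DecidableEq n] (v : n → V) :
    matAct (1 : Matrix n n (Module.End K V)) v = v := by
  ext i
  rw [matAct_apply, Finset.sum_eq_single i]
  · simp
  · intro j _ hj
    simp [Matrix.one_apply_ne hj.symm]
  · simp

theorem isFinRank_matAct_sub {m n : Type} [Fintype n] [Fintype m]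
    {M N : Matrix m n (Module.End K V)} (h : ∀ i j, IsFinRank (M i j - N i j)) :
    IsFinRank (matAct M - matAct N) := by
  classical
  have h1 : matAct M - matAct N = ∑ i, ∑ j,
      LinearMap.single K (fun _ : m => V) i ∘ₗ (M i j - N i j) ∘ₗ LinearMap.proj j := by
    refine LinearMap.ext fun v => funext fun i => ?_
    simp only [LinearMap.sub_apply, Pi.sub_apply, matAct_apply, LinearMap.sum_apply,
      Finset.sum_apply, LinearMap.comp_apply, LinearMap.proj_apply, LinearMap.single_apply]
    rw [Finset.sum_eq_single i]
    · simp [Finset.sum_sub_distrib]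
    · intro j _ hj
      simp [Pi.single_eq_of_ne hj.symm]
    · simp
  rw [h1]
  exact IsFinRank.sum _ fun i _ => IsFinRank.sum _ fun j _ => ((h i j).comp_right _).comp_left _

end MatAct

namespace Q

open RatFuncSplit

variable {K : Type u} [Field K]

theorem toRatFunc_e₁ : toRatFunc K (e₁ K) = 0 := map_zero (Q1.toRatFunc K)

theorem toRatFunc_e₂ : toRatFunc K (e₂ K) = 0 := Q1_toRatFunc_e

variable (K) in
/-- The idempotent matrix `diag(1, …, 1, e₁, …, e₁)`. -/
abbrev stdIdem (k a : ℕ) : Matrix (Fin k ⊕ Fin a) (Fin k ⊕ Fin a) (Q K) :=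
  blockSum (1 : Matrix (Fin k) (Fin k) (Q K)) (diagMat (e₁ K) (Fin a))

theorem stdIdem_idem (k a : ℕ) : IsIdempotentElem (stdIdem K k a) :=
  blockSum_idem IsIdempotentElem.one (VMonoid.diagonal_idem (e₁_idem K) _)

theorem le_of_matEquiv_stdIdem {k a b : ℕ} (h : MatEquiv (stdIdem K k a) (stdIdem K k b)) :
    b ≤ a := by
  obtain ⟨U₀, W₀, h1, h2⟩ := h
  set E := stdIdem K k a with hE
  set E' := stdIdem K k b with hE'
  have hEi : E * E = E := stdIdem_idem k a
  have hEi' : E' * E' = E' := stdIdem_idem k b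
  set U := E * U₀ with hU
  set W := W₀ * E with hW
  have hUE : U = U * E' := by
    rw [hU, ← h2, Matrix.mul_assoc, ← Matrix.mul_assoc U₀, h1, ← Matrix.mul_assoc E, hEi]
  have hEU : E * U = U := by rw [hU, ← Matrix.mul_assoc, hEi]
  have hUW : U * W = E := by
    rw [hU, hW, Matrix.mul_assoc, ← Matrix.mul_assoc U₀, h1, hEi, hEi]
  have hWU : W * U = E' := by
    rw [hU, hW, Matrix.mul_assoc, ← Matrix.mul_assoc E, hEi, ← h1, Matrix.mul_assoc,
      ← Matrix.mul_assoc W₀, h2, hEi']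
  -- the images over `K(x)`
  set π := (toRatFunc K : Q K →+* RatFunc K) with hπ
  -- Since U = UE' and e₁ maps to 0, the e₁-columns of U vanish over K(x). Hence the upper left
  -- blocks of U and W are mutually inverse there.
  have hUπ : ∀ i j, π (U i (.inr j)) = 0 := fun i j => by
    rw [hUE, Matrix.mul_apply, map_sum]
    refine Finset.sum_eq_zero fun s _ => ?_
    have : π (E' s (.inr j)) = 0 := by
      rcases s with s | s
      · exact map_zero π
      · change π (Matrix.diagonal (fun _ => e₁ K) s j) = 0
        rw [Matrix.diagonal_apply]
        split_ifs
        · exact toRatFunc_e₁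
        · exact map_zero π
    rw [map_mul, this, mul_zero]
  set u : Matrix (Fin k) (Fin k) (RatFunc K) := U.toBlocks₁₁.map π with hu
  set w : Matrix (Fin k) (Fin k) (RatFunc K) := W.toBlocks₁₁.map π with hw
  have huw : u * w = 1 := by
    ext i j
    have h3 := congrArg π (congrFun (congrFun hUW (.inl i)) (.inl j))
    rw [Matrix.mul_apply, map_sum, Fintype.sum_sum_type] at h3
    simp only [map_mul, hUπ, zero_mul, Finset.sum_const_zero, add_zero] at h3
    rw [Matrix.mul_apply]
    refine h3.trans ?_
    change π ((1 : Matrix (Fin k) (Fin k) (Q K)) i j) = _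
    rw [Matrix.one_apply, Matrix.one_apply]
    split_ifs
    · exact map_one π
    · exact map_zero π
  have hwu : w * u = 1 := mul_eq_one_comm.1 huw
  set u' : Matrix (Fin k) (Fin k) (Module.End K (RatFunc K)) := u.map (Algebra.lmul K (RatFunc K))
    with hu'
  set w' : Matrix (Fin k) (Fin k) (Module.End K (RatFunc K)) := w.map (Algebra.lmul K (RatFunc K))
    with hw'
  have huw' : u' * w' = 1 := by
    have h3 := Matrix.map_mul (L := u) (M := w)
      (f := (Algebra.lmul K (RatFunc K) : RatFunc K →+* Module.End K (RatFunc K)))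
    rw [huw] at h3
    exact h3.symm.trans (Matrix.map_one _ (map_zero _) (map_one _))
  have hwu' : w' * u' = 1 := by
    have h3 := Matrix.map_mul (L := w) (M := u)
      (f := (Algebra.lmul K (RatFunc K) : RatFunc K →+* Module.End K (RatFunc K)))
    rw [hwu] at h3
    exact h3.symm.trans (Matrix.map_one _ (map_zero _) (map_one _))
  let h : (Fin k → RatFunc K) ≃ₗ[K] (Fin k → RatFunc K) :=
    LinearEquiv.ofLinearMap (matAct u') (matAct w')
      (LinearMap.ext fun v => by
        rw [LinearMap.comp_apply, ← matAct_mul, huw', matAct_one, LinearMap.id_apply])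
      (LinearMap.ext fun v => by
        rw [LinearMap.comp_apply, ← matAct_mul, hwu', matAct_one, LinearMap.id_apply])
  -- the representation on `K(x)`
  set T := rep K with hT
  set ε := T (e₁ K) with hε
  have hεε : ∀ x, ε (ε x) = ε x := fun x => by
    rw [← Module.End.mul_apply, hε, ← map_mul, (e₁_idem K).eq]
  have hεfin : FiniteDimensional K (LinearMap.range ε) := by
    have h3 := isFinRank_rep_sub K (e₁ K)
    rw [toRatFunc_e₁, mulF, map_zero, sub_zero] at h3
    exact h3
  have hεpos : 0 < Module.finrank K (LinearMap.range ε) := by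
    rw [Module.finrank_pos_iff_exists_ne_zero]
    by_contra! hcon
    refine rep_e₁_ne_zero K (LinearMap.ext fun x => ?_)
    exact congrArg Subtype.val (hcon ⟨ε x, x, rfl⟩)
  have hTmul : ∀ {l m n : Type} [Fintype m] [Fintype n] (A : Matrix l m (Q K))
      (B : Matrix m n (Q K)) (v : n → RatFunc K),
      matAct ((A * B).map T) v = matAct (A.map T) (matAct (B.map T) v) := by
    intro l m n _ _ A B v
    rw [← matAct_mul, Matrix.map_mul]
  have hTE : ∀ (c : ℕ) (v : Fin k ⊕ Fin c → RatFunc K), matAct ((stdIdem K k c).map T) v =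
      Sum.elim (fun i => v (.inl i)) (fun i => ε (v (.inr i))) := by
    intro c v
    ext i
    rw [matAct_apply, Fintype.sum_sum_type]
    rcases i with i | i
    · simp [stdIdem, blockSum, Matrix.one_apply, apply_ite T, Finset.sum_ite_eq,
        DFunLike.ite_apply]
    · simp [stdIdem, blockSum, Matrix.diagonal_apply, apply_ite T, DFunLike.ite_apply, hε]
  -- With N the range of ε, the map J identifies K(x)^k × N^b with the range of E', and the kernel
  -- of R is that of E. The composite G is injective because EU = U and WU = E'.
  let J : ((Fin k → RatFunc K) × (Fin b → LinearMap.range ε)) →ₗ[K] (Fin k ⊕ Fin b → RatFunc K) :=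
    { toFun := fun z => Sum.elim z.1 (fun i => (z.2 i : RatFunc K))
      map_add' := fun y z => by ext i; rcases i with i | i <;> simp
      map_smul' := fun c z => by ext i; rcases i with i | i <;> simp }
  let R : (Fin k ⊕ Fin a → RatFunc K) →ₗ[K] ((Fin k → RatFunc K) × (Fin a → LinearMap.range ε)) :=
    { toFun := fun v => (fun i => v (.inl i), fun i => ε.rangeRestrict (v (.inr i)))
      map_add' := fun y z => by ext i <;> simp
      map_smul' := fun c z => by ext i <;> simp }
  have hJ : ∀ z, matAct (E'.map T) (J z) = J z := by
    intro z
    rw [hTE]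
    ext i
    rcases i with i | i
    · rfl
    · obtain ⟨x, hx⟩ := (z.2 i).2
      change ε (z.2 i : RatFunc K) = (z.2 i : RatFunc K)
      rw [← hx, hεε]
  let G := R ∘ₗ matAct (U.map T) ∘ₗ J
  have hG : Function.Injective G := by
    rw [← LinearMap.ker_eq_bot, LinearMap.ker_eq_bot']
    intro z hz
    set v := matAct (U.map T) (J z) with hv
    have hz' : R v = 0 := hz
    have h3 : matAct (E.map T) v = 0 := by
      rw [hTE]
      ext i
      rcases i with i | i
      · exact congrFun (congrArg Prod.fst hz') i
      · exact congrArg Subtype.val (congrFun (congrArg Prod.snd hz') i)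
    have h4 : v = 0 := by rw [hv, ← hEU, hTmul, ← hv, h3]
    have h5 : J z = 0 := by rw [← hJ, ← hWU, hTmul, ← hv, h4, map_zero]
    refine Prod.ext (funext fun i => congrFun h5 (.inl i))
      (funext fun i => Subtype.ext (congrFun h5 (.inr i)))
  -- The first block of G is that of U acting through `rep`, which is the bijective u' up to finite
  -- rank.
  have hfin : IsFinRank (LinearMap.fst K _ _ ∘ₗ G ∘ₗ LinearMap.inl K _ _ - h.toLinearMap) := by
    have h3 : LinearMap.fst K _ _ ∘ₗ G ∘ₗ LinearMap.inl K _ _ - h.toLinearMap =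
        matAct (U.toBlocks₁₁.map T) - matAct u' := by
      congr 1
      refine LinearMap.ext fun v => funext fun i => ?_
      change matAct (U.map T) (J (v, 0)) (.inl i) = _
      rw [matAct_apply, matAct_apply, Fintype.sum_sum_type]
      simp [J, Matrix.toBlocks₁₁]
    rw [h3]
    exact isFinRank_matAct_sub fun i j => isFinRank_rep_sub K _
  have h6 := finrank_le_of_injective_of_isFinRank G hG h hfin
  rw [Module.finrank_pi_fintype, Module.finrank_pi_fintype] at h6
  simp only [Finset.sum_const, Finset.card_univ, Fintype.card_fin, smul_eq_mul] at h6
  exact Nat.le_of_mul_le_mul_right h6 hεpos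

theorem eq_of_nsmul_add_nsmul_eq {k a b : ℕ}
    (h : k • VMonoid.cls (1 : Q K) IsIdempotentElem.one + a • VMonoid.cls (e₁ K) (e₁_idem K) =
      k • VMonoid.cls (1 : Q K) IsIdempotentElem.one + b • VMonoid.cls (e₁ K) (e₁_idem K)) :
    a = b := by
  have key : ∀ a, k • VMonoid.cls (1 : Q K) IsIdempotentElem.one +
      a • VMonoid.cls (e₁ K) (e₁_idem K) = VMonoid.ofMat (stdIdem K k a) (stdIdem_idem k a) := by
    intro a
    rw [VMonoid.ofMat_blockSum IsIdempotentElem.one (VMonoid.diagonal_idem (e₁_idem K) _),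
      VMonoid.ofMat_diagonal, ← VMonoid.ofMat_diagonal IsIdempotentElem.one,
      VMonoid.ofMat_congr Matrix.diagonal_one _ IsIdempotentElem.one]
  rw [key, key, VMonoid.ofMat_eq_iff] at h
  exact le_antisymm (le_of_matEquiv_stdIdem h.symm) (le_of_matEquiv_stdIdem h)

end Q

end

/-! ### Normal forms in `M̄` -/

noncomputable section

namespace Mbar

theorem rel {a b : Multiset MbarGen} (h : MbarRel a b) :
    AddCon.mk' (addConGen MbarRel) a = AddCon.mk' (addConGen MbarRel) b :=
  (AddCon.eq _).2 (AddConGen.Rel.of _ _ h)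

theorem x_eq_x_succ_add_y (l : ℕ) : x l = x (l + 1) + y := by
  have h := rel (.stepY l)
  rwa [map_add] at h

theorem x_eq_x_succ_add_z (l : ℕ) : x l = x (l + 1) + z := by
  have h := rel (.stepZ l)
  rwa [map_add] at h

theorem x_add_y (l : ℕ) : x l + y = x l + z := by
  cases l with
  | zero =>
    have h := rel .base
    rwa [map_add, map_add] at h
  | succ l => rw [← x_eq_x_succ_add_y, ← x_eq_x_succ_add_z]

theorem x_eq_x_add_nsmul_y (l d : ℕ) : x l = x (l + d) + d • y := by
  induction d with
  | zero => simp
  | succ d ih => rw [ih, x_eq_x_succ_add_y (l + d), succ_nsmul']; abel_nf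

/-- Replacing x̄ₘ by x̄ₗ₊ₘ releases l copies of ȳ, which turn x̄ₗ into x̄₀. -/
theorem x_add_x (l m : ℕ) : x l + x m = x 0 + x (l + m) := by
  conv_lhs => rw [x_eq_x_add_nsmul_y m l]
  conv_rhs => rw [x_eq_x_add_nsmul_y 0 l, zero_add]
  rw [add_comm m l]
  abel

/-- A normal form for the elements of `M̄`. -/
theorem exists_normal_form (u : Mbar) :
    (∃ a b : ℕ, u = a • y + b • z) ∨ ∃ k N n : ℕ, u = k • x 0 + x N + n • y := by
  obtain ⟨s, rfl⟩ := AddCon.mk'_surjective u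
  induction s using Multiset.induction_on with
  | empty => exact Or.inl ⟨0, 0, by rw [map_zero]; simp⟩
  | cons g s ih =>
    rw [← Multiset.singleton_add, map_add]
    rcases ih with ⟨a, b, h⟩ | ⟨k, N, n, h⟩
    · rw [h]
      cases g with
      | x l =>
        refine Or.inr ⟨0, l, a + b, ?_⟩
        change x l + _ = _
        have hz : ∀ b : ℕ, x l + b • z = x l + b • y := by
          intro b
          induction b with
          | zero => simp
          | succ b ih => rw [succ_nsmul, succ_nsmul, ← add_assoc, ih, add_right_comm, ← x_add_y,
              add_right_comm, add_assoc]
        rw [add_comm (a • y), ← add_assoc, hz, add_smul]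
        abel
      | y => exact Or.inl ⟨a + 1, b, by change y + _ = _; rw [succ_nsmul]; abel⟩
      | z => exact Or.inl ⟨a, b + 1, by change z + _ = _; rw [succ_nsmul]; abel⟩
    · rw [h]
      right
      cases g with
      | x l =>
        refine ⟨k + 1, l + N, n, ?_⟩
        change x l + _ = _
        have : x l + (k • x 0 + x N + n • y) = k • x 0 + (x l + x N) + n • y := by abel
        rw [this, x_add_x, succ_nsmul]
        abel
      | y => exact ⟨k, N, n + 1, by change y + _ = _; rw [succ_nsmul]; abel⟩
      | z =>
        refine ⟨k, N, n + 1, ?_⟩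
        change z + _ = _
        have : z + (k • x 0 + x N + n • y) = k • x 0 + (x N + z) + n • y := by abel
        rw [this, ← x_add_y, succ_nsmul]
        abel

/-- Raising N by d releases d copies of ȳ, so for fixed k only n - N matters. -/
theorem normal_form_eq {k N n N' n' : ℕ} (h : n + N' = n' + N) :
    k • x 0 + x N + n • y = k • x 0 + x N' + n' • y := by
  have key : ∀ N n d : ℕ, k • x 0 + x N + n • y = k • x 0 + x (N + d) + (n + d) • y := by
    intro N n d
    rw [x_eq_x_add_nsmul_y N d, add_smul]
    abel
  rcases Nat.le_total N N' with hN | hN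
  · obtain ⟨d, rfl⟩ := Nat.exists_eq_add_of_le hN
    obtain rfl : n' = n + d := by omega
    exact key N n d
  · obtain ⟨d, rfl⟩ := Nat.exists_eq_add_of_le hN
    obtain rfl : n = n' + d := by omega
    exact (key N' n' d).symm

end Mbar

/-! ### The homomorphism `psi` and its bijectivity -/

namespace Q

variable {K : Type u} [Field K]

/-- The difference p n - p (n+1) = Yⁿe₂Xⁿ is equivalent to e₂, because e₂XⁿYⁿ = e₂. -/
theorem cls_p_eq_add_e₂ (n : ℕ) : VMonoid.cls (p K n) (p_idem K n) =
    VMonoid.cls (p K (n + 1)) (p_idem K (n + 1)) + VMonoid.cls (e₂ K) (e₂_idem K) := by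
  have hXY : ∀ a : Q K, e₂ K * (X K ^ n * Y K ^ n * a) = e₂ K * a := by
    intro a
    ext
    · change Q1.e K * (Q1.x K ^ n * Q1.y K ^ n * a.1.1) = _
      rw [Q1.x_pow_mul_y_pow, one_mul]; rfl
    · simp
  have hYe : Y K ^ n * e₂ K * X K ^ n = p K n - p K (n + 1) := by
    ext
    · change Q1.y K ^ n * Q1.e K * Q1.x K ^ n =
        Q1.y K ^ n * Q1.x K ^ n - Q1.y K ^ (n + 1) * Q1.x K ^ (n + 1)
      rw [Q1.e, pow_succ, pow_succ' (Q1.x K)]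
      noncomm_ring
    · change Q1.x K ^ n * (0 * Q1.y K ^ n) = 1 - 1
      rw [zero_mul, mul_zero, sub_self]
  have hpp : p K n * p K (n + 1) = p K (n + 1) := by
    ext
    · change Q1.y K ^ n * Q1.x K ^ n * (Q1.y K ^ (n + 1) * Q1.x K ^ (n + 1)) = _
      rw [pow_succ (Q1.y K), mul_assoc, ← mul_assoc (Q1.x K ^ n), ← mul_assoc (Q1.x K ^ n),
        Q1.x_pow_mul_y_pow, one_mul, ← mul_assoc, ← pow_succ]
      rfl
    · simp
  have hpp' : p K (n + 1) * p K n = p K (n + 1) := by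
    ext
    · change Q1.y K ^ (n + 1) * Q1.x K ^ (n + 1) * (Q1.y K ^ n * Q1.x K ^ n) = _
      rw [pow_succ' (Q1.x K), mul_assoc, mul_assoc (Q1.x K), ← mul_assoc (Q1.x K ^ n),
        Q1.x_pow_mul_y_pow, one_mul, ← pow_succ']
      rfl
    · simp
  have hi : IsIdempotentElem (p K n - p K (n + 1)) := by
    rw [IsIdempotentElem, sub_mul, mul_sub, mul_sub, (p_idem K n).eq, (p_idem K (n + 1)).eq,
      hpp, hpp']
    abel
  rw [VMonoid.cls_add (p_idem K (n + 1)) hi (p_idem K n)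
    (by rw [mul_sub, hpp', (p_idem K (n + 1)).eq, sub_self])
    (by rw [sub_mul, hpp, (p_idem K (n + 1)).eq, sub_self]) (by abel)]
  congr 1
  refine VMonoid.cls_eq_cls _ _ (Y K ^ n * e₂ K) (e₂ K * X K ^ n) ?_ ?_
  · rw [← mul_assoc, mul_assoc (Y K ^ n), (e₂_idem K).eq, hYe]
  · rw [mul_assoc, ← mul_assoc (X K ^ n), hXY, (e₂_idem K).eq]

theorem cls_q_eq_add_e₁ (n : ℕ) : VMonoid.cls (q K n) (q_idem K n) =
    VMonoid.cls (q K (n + 1)) (q_idem K (n + 1)) + VMonoid.cls (e₁ K) (e₁_idem K) := by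
  have hXe : X K ^ n * e₁ K * Y K ^ n = q K n - q K (n + 1) := by
    ext
    · change Q1.x K ^ n * 0 * Q1.y K ^ n = 1 - 1
      rw [mul_zero, zero_mul, sub_self]
    · change Q1.y K ^ n * (Q1.e K * Q1.x K ^ n) =
        Q1.y K ^ n * Q1.x K ^ n - Q1.y K ^ (n + 1) * Q1.x K ^ (n + 1)
      rw [Q1.e, pow_succ, pow_succ' (Q1.x K)]
      noncomm_ring
  have hYX : ∀ a : Q K, e₁ K * (Y K ^ n * X K ^ n * a) = e₁ K * a := by
    intro a
    ext
    · simp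
    · change a.1.2.unop * (Q1.x K ^ n * Q1.y K ^ n) * Q1.e K = _
      rw [Q1.x_pow_mul_y_pow, mul_one]; rfl
  have hqq : q K n * q K (n + 1) = q K (n + 1) := by
    ext
    · simp
    · change Q1.y K ^ (n + 1) * Q1.x K ^ (n + 1) * (Q1.y K ^ n * Q1.x K ^ n) = _
      rw [pow_succ' (Q1.x K), mul_assoc, mul_assoc (Q1.x K), ← mul_assoc (Q1.x K ^ n),
        Q1.x_pow_mul_y_pow, one_mul, ← pow_succ']
      rfl
  have hqq' : q K (n + 1) * q K n = q K (n + 1) := by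
    ext
    · simp
    · change Q1.y K ^ n * Q1.x K ^ n * (Q1.y K ^ (n + 1) * Q1.x K ^ (n + 1)) = _
      rw [pow_succ (Q1.y K), mul_assoc, ← mul_assoc (Q1.x K ^ n), ← mul_assoc (Q1.x K ^ n),
        Q1.x_pow_mul_y_pow, one_mul, ← mul_assoc, ← pow_succ]
      rfl
  have hi : IsIdempotentElem (q K n - q K (n + 1)) := by
    rw [IsIdempotentElem, sub_mul, mul_sub, mul_sub, (q_idem K n).eq, (q_idem K (n + 1)).eq,
      hqq, hqq']
    abel
  rw [VMonoid.cls_add (q_idem K (n + 1)) hi (q_idem K n)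
    (by rw [mul_sub, hqq', (q_idem K (n + 1)).eq, sub_self])
    (by rw [sub_mul, hqq, (q_idem K (n + 1)).eq, sub_self]) (by abel)]
  congr 1
  refine VMonoid.cls_eq_cls _ _ (X K ^ n * e₁ K) (e₁ K * Y K ^ n) ?_ ?_
  · rw [← mul_assoc, mul_assoc (X K ^ n), (e₁_idem K).eq, hXe]
  · rw [mul_assoc, ← mul_assoc (Y K ^ n), hYX, (e₁_idem K).eq]

theorem cls_p_eq_add_e₁ (n : ℕ) : VMonoid.cls (p K n) (p_idem K n) =
    VMonoid.cls (p K (n + 1)) (p_idem K (n + 1)) + VMonoid.cls (e₁ K) (e₁_idem K) := by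
  rw [cls_p_eq_cls_q, cls_p_eq_cls_q, cls_q_eq_add_e₁]

theorem cls_p_zero : VMonoid.cls (p K 0) (p_idem K 0) =
    VMonoid.cls (1 : Q K) IsIdempotentElem.one := by
  refine VMonoid.cls_congr ?_ _ _
  ext
  · change Q1.y K ^ 0 * Q1.x K ^ 0 = 1
    simp
  · rfl

variable (K) in
/-- The classes in `V(Q)` of the generators of `M̄`. -/
def genCls : MbarGen → VMonoid (Q K)
  | .x n => VMonoid.cls (p K (n + 1)) (p_idem K (n + 1))
  | .y => VMonoid.cls (e₁ K) (e₁_idem K)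
  | .z => VMonoid.cls (e₂ K) (e₂_idem K)

variable (K) in
/-- The homomorphism from the free commutative monoid on the generators of `M̄` to `V(Q)`. -/
def genHom : Multiset MbarGen →+ VMonoid (Q K) :=
  Multiset.sumAddMonoidHom.comp (Multiset.mapAddMonoidHom (genCls K))

theorem genHom_singleton (g : MbarGen) : genHom K {g} = genCls K g := by
  simp [genHom]

variable (K) in
/-- The homomorphism `M̄ → V(Q)`. -/
def psi : Mbar →+ VMonoid (Q K) :=
  AddCon.lift _ (genHom K) (AddCon.addConGen_le.2 fun a b h => by
    change genHom K a = genHom K b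
    cases h with
    | base =>
      rw [map_add, map_add, genHom_singleton, genHom_singleton, genHom_singleton]
      -- Both sides are [p 0], the class of 1.
      exact (cls_p_eq_add_e₁ 0).symm.trans (cls_p_eq_add_e₂ 0)
    | stepY l =>
      rw [map_add, genHom_singleton, genHom_singleton, genHom_singleton]
      exact cls_p_eq_add_e₁ (l + 1)
    | stepZ l =>
      rw [map_add, genHom_singleton, genHom_singleton, genHom_singleton]
      exact cls_p_eq_add_e₂ (l + 1))

theorem psi_gen (g : MbarGen) : psi K (Mbar.gen g) = genCls K g := by
  change AddCon.lift _ (genHom K) _ (AddCon.mk' _ _) = _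
  rw [AddCon.lift_mk', genHom_singleton]

theorem psi_x (n : ℕ) :
    psi K (Mbar.x n) = VMonoid.cls (p K (n + 1)) (p_idem K (n + 1)) := psi_gen _

theorem psi_y : psi K Mbar.y = VMonoid.cls (e₁ K) (e₁_idem K) := psi_gen _

theorem psi_z : psi K Mbar.z = VMonoid.cls (e₂ K) (e₂_idem K) := psi_gen _

theorem psi_surjective : Function.Surjective (psi K) := by
  intro v
  induction v using Quotient.inductionOn with | _ E
  obtain ⟨k, N, a, b, h⟩ := exists_ofMat_eq E.2.2
  refine ⟨k • Mbar.x N + (a • Mbar.y + b • Mbar.z), ?_⟩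
  change _ = VMonoid.mk E
  rw [VMonoid.mk_eq_ofMat, h]
  simp only [map_add, map_nsmul, psi_x, psi_y, psi_z]

variable (K) in
/-- The projection of `Q` to `Q₁`. -/
def fstHom : Q K →+* Q1 K := (RingHom.fst (Q1 K) (Q1 K)ᵐᵒᵖ).comp (pullbackQ K).val.toRingHom

variable (K) in
/-- The projection of `Q` to `Q₁ᵒᵖᵖ`. -/
def sndHom : Q K →+* (Q1 K)ᵐᵒᵖ :=
  (RingHom.snd (Q1 K) (Q1 K)ᵐᵒᵖ).comp (pullbackQ K).val.toRingHom

theorem Q1_e_ne_zero : Q1.e K ≠ 0 := by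
  intro h
  refine rep_e₁_ne_zero K ?_
  have : e₁ K = 0 := by ext <;> simp [h]
  rw [this, map_zero]

theorem map_fst_psi (a b : ℕ) : VMonoid.map (fstHom K) (psi K (a • Mbar.y + b • Mbar.z)) =
    b • VMonoid.cls (Q1.e K) Q1.e_idem := by
  rw [map_add, map_nsmul, map_nsmul, psi_y, psi_z, map_add, map_nsmul, map_nsmul,
    VMonoid.map_cls, VMonoid.map_cls]
  have h : VMonoid.cls (fstHom K (e₁ K)) ((e₁_idem K).map _) = 0 :=
    (VMonoid.cls_congr rfl _ IsIdempotentElem.zero).trans (VMonoid.cls_zero _)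
  rw [h, smul_zero, zero_add]
  rfl

theorem op_e_idem : IsIdempotentElem (MulOpposite.op (Q1.e K)) :=
  congrArg MulOpposite.op Q1.e_idem

theorem map_snd_psi (a b : ℕ) : VMonoid.map (sndHom K) (psi K (a • Mbar.y + b • Mbar.z)) =
    a • VMonoid.cls (MulOpposite.op (Q1.e K)) op_e_idem := by
  rw [map_add, map_nsmul, map_nsmul, psi_y, psi_z, map_add, map_nsmul, map_nsmul,
    VMonoid.map_cls, VMonoid.map_cls]
  have h : VMonoid.cls (sndHom K (e₂ K)) ((e₂_idem K).map _) = 0 :=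
    (VMonoid.cls_congr rfl _ IsIdempotentElem.zero).trans (VMonoid.cls_zero _)
  rw [h, smul_zero, add_zero]
  rfl

variable (K) in
/-- The rank of the image in `K(x)`, as an element of `V(K(x))`. -/
abbrev rank : VMonoid (Q K) →+ VMonoid (RatFunc K) :=
  VMonoid.map (toRatFunc K : Q K →+* RatFunc K)

theorem rank_e₁ : rank K (VMonoid.cls (e₁ K) (e₁_idem K)) = 0 := by
  rw [rank, VMonoid.map_cls]
  exact (VMonoid.cls_congr toRatFunc_e₁ _ IsIdempotentElem.zero).trans (VMonoid.cls_zero _)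

theorem rank_e₂ : rank K (VMonoid.cls (e₂ K) (e₂_idem K)) = 0 := by
  rw [rank, VMonoid.map_cls]
  exact (VMonoid.cls_congr toRatFunc_e₂ _ IsIdempotentElem.zero).trans (VMonoid.cls_zero _)

theorem rank_p (n : ℕ) : rank K (VMonoid.cls (p K n) (p_idem K n)) =
    VMonoid.cls (1 : RatFunc K) IsIdempotentElem.one := by
  rw [rank, VMonoid.map_cls]
  exact VMonoid.cls_congr (toRatFunc_yx K n) _ _

theorem rank_psi_polar (a b : ℕ) : rank K (psi K (a • Mbar.y + b • Mbar.z)) =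
    0 • VMonoid.cls (1 : RatFunc K) IsIdempotentElem.one := by
  simp only [map_add, map_nsmul, psi_y, psi_z, rank_e₁, rank_e₂, smul_zero, add_zero, zero_smul]

theorem rank_psi (k N n : ℕ) : rank K (psi K (k • Mbar.x 0 + Mbar.x N + n • Mbar.y)) =
    (k + 1) • VMonoid.cls (1 : RatFunc K) IsIdempotentElem.one := by
  simp only [map_add, map_nsmul, psi_x, psi_y, rank_e₁, rank_p, smul_zero, add_zero, succ_nsmul]

theorem cls_one_nsmul_injective {s t : ℕ}
    (h : s • VMonoid.cls (1 : RatFunc K) IsIdempotentElem.one =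
      t • VMonoid.cls (1 : RatFunc K) IsIdempotentElem.one) : s = t :=
  VMonoid.nsmul_cls_injective (RatFunc K) IsIdempotentElem.one one_ne_zero
    (fun a => ⟨a, by simp⟩) h

/-- N copies of ȳ turn x̄_N into x̄₀, and one more for each of the k + 1 copies of x̄₀ gives [1].
The extra N' makes the added multiple of [e₁] symmetric in N and N', so it can be added to both
sides of an equation. -/
theorem psi_normal_form_add (k N N' n : ℕ) :
    psi K (k • Mbar.x 0 + Mbar.x N + n • Mbar.y) +
        (N + N' + (k + 1)) • VMonoid.cls (e₁ K) (e₁_idem K) =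
      (k + 1) • VMonoid.cls (1 : Q K) IsIdempotentElem.one +
        (n + N') • VMonoid.cls (e₁ K) (e₁_idem K) := by
  have h0 : VMonoid.cls (1 : Q K) IsIdempotentElem.one = psi K (Mbar.x 0 + Mbar.y) := by
    rw [map_add, psi_x, psi_y, ← cls_p_zero, cls_p_eq_add_e₁]
  rw [h0, ← psi_y, ← map_nsmul, ← map_add, ← map_nsmul, ← map_nsmul, ← map_add]
  congr 1
  have h1 := Mbar.x_eq_x_add_nsmul_y 0 N
  rw [zero_add] at h1
  have h2 : (k + 1) • (Mbar.x 0 + Mbar.y) =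
      k • Mbar.x 0 + (Mbar.x N + N • Mbar.y) + (k + 1) • Mbar.y := by
    rw [← h1, nsmul_add, succ_nsmul (Mbar.x 0)]
  rw [h2, add_smul, add_smul, add_smul n]
  abel

theorem psi_injective : Function.Injective (psi K) := by
  intro u v huv
  rcases Mbar.exists_normal_form u with ⟨a, b, rfl⟩ | ⟨k, N, n, rfl⟩ <;>
    rcases Mbar.exists_normal_form v with ⟨a', b', rfl⟩ | ⟨k', N', n', rfl⟩
  -- In rank 0 the first coordinate sees only z̄ and the second only ȳ.
  · have h1 := congrArg (VMonoid.map (fstHom K)) huv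
    have h2 := congrArg (VMonoid.map (sndHom K)) huv
    rw [map_fst_psi, map_fst_psi] at h1
    rw [map_snd_psi, map_snd_psi] at h2
    obtain rfl := VMonoid.nsmul_cls_injective K Q1.e_idem Q1_e_ne_zero Q1.exists_e_mul_mul_e h1
    obtain rfl := VMonoid.nsmul_cls_injective K op_e_idem
      (fun h => Q1_e_ne_zero (MulOpposite.op_injective h)) (fun a => by
        obtain ⟨c, hc⟩ := Q1.exists_e_mul_mul_e a.unop
        refine ⟨c, MulOpposite.unop_injective ?_⟩
        rw [MulOpposite.unop_smul, MulOpposite.unop_op, ← hc, mul_assoc]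
        rfl) h2
    rfl
  · have h := congrArg (rank K) huv
    rw [rank_psi_polar, rank_psi] at h
    exact absurd (cls_one_nsmul_injective h) (by omega)
  · have h := congrArg (rank K) huv
    rw [rank_psi_polar, rank_psi] at h
    exact absurd (cls_one_nsmul_injective h) (by omega)
  · have h := congrArg (rank K) huv
    rw [rank_psi, rank_psi] at h
    obtain rfl : k = k' := by have := cls_one_nsmul_injective h; omega
    apply Mbar.normal_form_eq
    -- The index argument needs unit blocks of equal size, here k + 1, which is the rank over K(x).
    apply eq_of_nsmul_add_nsmul_eq (K := K) (k := k + 1)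
    rw [← psi_normal_form_add, ← psi_normal_form_add k N' N n', huv, add_comm N N']

end Q

end

theorem proposition3p4 (K : Type*) [Field K] :
    IsVNRegular (Q K) ∧
    ∃ ψ : Mbar ≃+ VMonoid (Q K),
      (∀ n : ℕ,
        ψ (Mbar.x n) = VMonoid.cls (Q.p K (n + 1)) (Q.p_idem K (n + 1)) ∧
        VMonoid.cls (Q.p K (n + 1)) (Q.p_idem K (n + 1)) =
          VMonoid.cls (Q.q K (n + 1)) (Q.q_idem K (n + 1))) ∧
      ψ Mbar.y = VMonoid.cls (Q.e₁ K) (Q.e₁_idem K) ∧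
      ψ Mbar.z = VMonoid.cls (Q.e₂ K) (Q.e₂_idem K) :=
  ⟨Q.isVNRegular,
    AddEquiv.ofBijective (Q.psi K) ⟨Q.psi_injective, Q.psi_surjective⟩,
    fun n => ⟨Q.psi_x n, Q.cls_p_eq_cls_q (n + 1)⟩, Q.psi_y, Q.psi_z⟩
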